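/- Conventions. A lattice $\Lambda\subset\mathbb R^n$ (discrete, of full rank $n$) is integral if $u\cdot v\in\mathbb Z$ for all $u,v\in\Lambda$; an integral lattice is even if $u\cdot u\in 2\mathbb Z$ for all $u\in\Lambda$, and odd otherwise. Let $\Lambda^*$ be the dual lattice. For a set $\Pi$ of rational primes, the $\Pi$-dual $\Lambda^{*_\Pi}$ is the set of $v\in\Lambda\otimes\mathbb Q$ with $v\cdot\Lambda\subseteq\mathbb Z_p$ for all $p\in\Pi$ and $v\cdot\Lambda^*\subseteq\mathbb Z_p$ for all $p\notin\Pi$; write $\Lambda^{*_2}=\Lambda^{*_{\{2\}}}$. The even sublattice of an integral lattice $\Lambda$ is $\Lambda_0=\{u\in\Lambda: u\cdot u\in 2\mathbb Z_2\}$. A modularity of an integral lattice $\Lambda$ is a (linear) similarity $\sigma$ of $\mathbb R^n$ with $\sigma(\Lambda^{*_\Pi})=\Lambda$ for some set $\Pi$ of primes; it has level $N$ if $\sigma(x)\cdot\sigma(x)=N\,x\cdot x$ for all $x$ ($\Pi$ is then the set of primes dividing $N$, up to primes $p$ with $\Lambda\otimes\mathbb Z_p=\Lambda^*\otimes\mathbb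 Z_p$). An integral lattice is $\{2\}$-modular if it has a modularity of level $2$. Two lattices are rationally equivalent if the rational quadratic spaces $\Lambda\otimes\mathbb Q$ are isometric. The oddity of an integral lattice $\Lambda$ is the element of $\mathbb Z/8\mathbb Z$ obtained by diagonalising $\Lambda\otimes\mathbb Q$ over $\mathbb Q$ as $\mathrm{diag}(2^{k_1}u_1,\dots,2^{k_n}u_n)$, where the $u_i$ are rational numbers that are 2-adic units, and taking $\sum_i u_i+4\cdot\#\{i: k_i \text{ odd},\ u_i\equiv\pm3 \pmod 8\}$ modulo $8$ (this does not depend on the diagonalisation). Theorem. Let $\Lambda$ be an odd $\{2\}$-modular lattice whose dimension $n$ and oddity are both divisible by $4$. Then $\Lambda'=\sqrt2\,(\Lambda_0)^{*_2}$ is an integral lattice, and $\Lambda''=(\Lambda')'=\sqrt2\,((\Lambda')_0)^{*_2}$ is an even $\{2\}$-modular lattice that is rationally equivalent to $\Lambda$. Moreover, every modularity $\sigma$ of $\Lambda$ is also a modularity of $\Lambda''$ (for the same similarity $\sigma$, hence with the same level). -/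

import Mathlib

namespace ModularLattice

/-- The real number `x` is rational and lies in `ℤ_p`: its reduced denominator is prime to `p`. -/
def IsPInt (p : ℕ) (x : ℝ) : Prop :=
  ∃ q : ℚ, (q : ℝ) = x ∧ ¬ p ∣ q.den

theorem IsPInt.zero {p : ℕ} (hp : p.Prime) : IsPInt p 0 :=
  ⟨0, by simp, by simpa using hp.ne_one⟩

theorem IsPInt.add {p : ℕ} (hp : p.Prime) {x y : ℝ} (hx : IsPInt p x) (hy : IsPInt p y) :
    IsPInt p (x + y) := by
  obtain ⟨a, rfl, ha⟩ := hx
  obtain ⟨b, rfl, hb⟩ := hy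
  refine ⟨a + b, by push_cast; ring, fun h => ?_⟩
  rcases (hp.dvd_mul).1 (h.trans (Rat.add_den_dvd a b)) with h | h
  · exact ha h
  · exact hb h

theorem IsPInt.int_mul {p : ℕ} (k : ℤ) {x : ℝ} (hx : IsPInt p x) :
    IsPInt p (k * x) := by
  obtain ⟨a, rfl, ha⟩ := hx
  refine ⟨k * a, by push_cast; ring, fun h => ha (h.trans ?_)⟩
  simpa using Rat.mul_den_dvd (k : ℚ) a

/-- `L` is a (full-rank) lattice in `ℝⁿ`. -/
def IsLattice {n : ℕ} (L : Submodule ℤ (EuclideanSpace ℝ (Fin n))) : Prop :=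
  ∃ _ : DiscreteTopology L, IsZLattice ℝ L

/-- `L` is an integral lattice: all inner products of its vectors are integers. -/
structure IsIntegral {n : ℕ} (L : Submodule ℤ (EuclideanSpace ℝ (Fin n))) : Prop where
  isLattice : IsLattice L
  integral : ∀ u ∈ L, ∀ v ∈ L, ∃ k : ℤ, inner ℝ u v = (k : ℝ)

/-- An integral lattice is even if all its norms `u · u` are even integers. -/
structure IsEven {n : ℕ} (L : Submodule ℤ (EuclideanSpace ℝ (Fin n))) : Prop
    extends IsIntegral L where
  even : ∀ u ∈ L, ∃ k : ℤ, inner ℝ u u = 2 * (k : ℝ)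

/-- An integral lattice is odd if it is not even. -/
def IsOdd {n : ℕ} (L : Submodule ℤ (EuclideanSpace ℝ (Fin n))) : Prop :=
  IsIntegral L ∧ ¬ IsEven L

/-- The dual lattice `L*`: the vectors whose inner products with `L` are integers. -/
noncomputable def dual {n : ℕ} (L : Submodule ℤ (EuclideanSpace ℝ (Fin n))) :
    Submodule ℤ (EuclideanSpace ℝ (Fin n)) :=
  LinearMap.BilinForm.dualSubmodule (innerₗ (EuclideanSpace ℝ (Fin n))) L

/-- The rational quadratic space `L ⊗ ℚ`, realised as the `ℚ`-span of `L`. -/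
noncomputable def ratSpan {n : ℕ} (L : Submodule ℤ (EuclideanSpace ℝ (Fin n))) :
    Submodule ℚ (EuclideanSpace ℝ (Fin n)) :=
  Submodule.span ℚ (L : Set (EuclideanSpace ℝ (Fin n)))

/-- The `S`-dual of `L` for a set `S` of rational primes: the vectors `v ∈ L ⊗ ℚ` such that
`v · L ⊆ ℤ_p` for `p ∈ S` and `v · L* ⊆ ℤ_p` for `p ∉ S`. -/
noncomputable def piDual {n : ℕ} (S : Set Nat.Primes)
    (L : Submodule ℤ (EuclideanSpace ℝ (Fin n))) :
    Submodule ℤ (EuclideanSpace ℝ (Fin n)) where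
  carrier := {v | v ∈ ratSpan L ∧
    (∀ p : Nat.Primes, p ∈ S → ∀ u ∈ L, IsPInt p (inner ℝ v u)) ∧
    (∀ p : Nat.Primes, p ∉ S → ∀ u ∈ dual L, IsPInt p (inner ℝ v u))}
  zero_mem' := by
    refine ⟨Submodule.zero_mem _, fun p _ u _ => ?_, fun p _ u _ => ?_⟩ <;>
      simpa using IsPInt.zero p.2
  add_mem' := by
    rintro v w ⟨hv, hv1, hv2⟩ ⟨hw, hw1, hw2⟩
    refine ⟨Submodule.add_mem _ hv hw, fun p hp u hu => ?_, fun p hp u hu => ?_⟩ <;>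
      rw [inner_add_left]
    · exact IsPInt.add p.2 (hv1 p hp u hu) (hw1 p hp u hu)
    · exact IsPInt.add p.2 (hv2 p hp u hu) (hw2 p hp u hu)
  smul_mem' := by
    rintro k v ⟨hv, hv1, hv2⟩
    have key : ∀ u : EuclideanSpace ℝ (Fin n), inner ℝ (k • v) u = (k : ℝ) * inner ℝ v u := by
      intro u
      rw [← Int.cast_smul_eq_zsmul ℝ, real_inner_smul_left]
    refine ⟨zsmul_mem hv k, fun p hp u hu => ?_, fun p hp u hu => ?_⟩ <;> rw [key]
    · exact IsPInt.int_mul k (hv1 p hp u hu)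
    · exact IsPInt.int_mul k (hv2 p hp u hu)

/-- The `2`-dual `L^{*₂}`, i.e. the `S`-dual for `S = {2}`. -/
noncomputable def twoDual {n : ℕ} (L : Submodule ℤ (EuclideanSpace ℝ (Fin n))) :
    Submodule ℤ (EuclideanSpace ℝ (Fin n)) :=
  piDual {(⟨2, Nat.prime_two⟩ : Nat.Primes)} L

/-- The even sublattice `L₀ = {u ∈ L : u · u ∈ 2 ℤ₂}`. For a 2-integral lattice this set is
already a subgroup (see `mem_evenSublattice`), so that taking the span adds nothing. -/
noncomputable def evenSublattice {n : ℕ} (L : Submodule ℤ (EuclideanSpace ℝ (Fin n))) :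
    Submodule ℤ (EuclideanSpace ℝ (Fin n)) :=
  Submodule.span ℤ {u | u ∈ L ∧ IsPInt 2 (inner ℝ u u / 2)}

theorem mem_evenSublattice {n : ℕ} {L : Submodule ℤ (EuclideanSpace ℝ (Fin n))}
    (hL : ∀ u ∈ L, ∀ v ∈ L, IsPInt 2 (inner ℝ u v)) (u : EuclideanSpace ℝ (Fin n)) :
    u ∈ evenSublattice L ↔ u ∈ L ∧ IsPInt 2 (inner ℝ u u / 2) := by
  refine ⟨fun h => ?_, fun h => Submodule.subset_span h⟩
  induction h using Submodule.span_induction with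
  | mem x h => exact h
  | zero => exact ⟨zero_mem _, by simpa using IsPInt.zero Nat.prime_two⟩
  | add x y _ _ hx hy =>
    refine ⟨add_mem hx.1 hy.1, ?_⟩
    have e : inner ℝ (x + y) (x + y) / 2
        = inner ℝ x x / 2 + inner ℝ y y / 2 + inner ℝ x y := by
      rw [real_inner_add_add_self]; ring
    rw [e]
    exact (hx.2.add Nat.prime_two hy.2).add Nat.prime_two (hL x hx.1 y hy.1)
  | smul k x _ hx =>
    refine ⟨L.smul_mem k hx.1, ?_⟩
    have e : inner ℝ (k • x) (k • x) / 2 = (k : ℝ) * ((k : ℝ) * (inner ℝ x x / 2)) := by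
      rw [← Int.cast_smul_eq_zsmul ℝ, real_inner_smul_left, real_inner_smul_right]; ring
    rw [e]
    exact (hx.2.int_mul k).int_mul k

/-- The lattice `c L` for a real scalar `c`. -/
noncomputable def scale {n : ℕ} (c : ℝ) (L : Submodule ℤ (EuclideanSpace ℝ (Fin n))) :
    Submodule ℤ (EuclideanSpace ℝ (Fin n)) :=
  L.map ((LinearMap.lsmul ℝ (EuclideanSpace ℝ (Fin n)) c).restrictScalars ℤ)

/-- The construction `L ↦ L' = √2 (L₀)^{*₂}`. -/
noncomputable def derived {n : ℕ} (L : Submodule ℤ (EuclideanSpace ℝ (Fin n))) :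
    Submodule ℤ (EuclideanSpace ℝ (Fin n)) :=
  scale (Real.sqrt 2) (twoDual (evenSublattice L))

/-- The linear map `σ` multiplies norms `x · x` by `N`. -/
def MultipliesNormsBy {n : ℕ} (N : ℝ)
    (σ : EuclideanSpace ℝ (Fin n) →ₗ[ℝ] EuclideanSpace ℝ (Fin n)) : Prop :=
  ∀ x, inner ℝ (σ x) (σ x) = N * inner ℝ x x

/-- `σ` is a modularity of the integral lattice `L`: a similarity of `ℝⁿ` that maps the
`S`-dual of `L` onto `L`, for some set `S` of primes. -/
def IsModularity {n : ℕ} (L : Submodule ℤ (EuclideanSpace ℝ (Fin n)))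
    (σ : EuclideanSpace ℝ (Fin n) →ₗ[ℝ] EuclideanSpace ℝ (Fin n)) : Prop :=
  (∃ N : ℝ, 0 < N ∧ MultipliesNormsBy N σ) ∧
  ∃ S : Set Nat.Primes, σ '' (piDual S L : Set (EuclideanSpace ℝ (Fin n))) = L

/-- `L` is `{l₁, l₂, …}`-modular: it is integral and has modularities of levels `l₁, l₂, …`,
where a modularity has level `N` if it multiplies norms by `N`. -/
def IsModular {n : ℕ} (levels : Set ℕ) (L : Submodule ℤ (EuclideanSpace ℝ (Fin n))) : Prop :=
  IsIntegral L ∧ ∀ l ∈ levels, ∃ σ : EuclideanSpace ℝ (Fin n) →ₗ[ℝ] EuclideanSpace ℝ (Fin n),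
    IsModularity L σ ∧ MultipliesNormsBy (l : ℝ) σ

/-- Rational equivalence: `L ⊗ ℚ` and `M ⊗ ℚ` are isometric rational quadratic spaces. -/
def RationallyEquivalent {n : ℕ} (L M : Submodule ℤ (EuclideanSpace ℝ (Fin n))) : Prop :=
  ∃ f : ratSpan L ≃ₗ[ℚ] ratSpan M, ∀ x y : ratSpan L,
    inner ℝ (f x : EuclideanSpace ℝ (Fin n)) (f y : EuclideanSpace ℝ (Fin n))
      = inner ℝ (x : EuclideanSpace ℝ (Fin n)) (y : EuclideanSpace ℝ (Fin n))

/-- The residue modulo 8 of the odd part `u` of a nonzero rational number `q = 2ᵏ u`. -/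
def oddPartModEight (q : ℚ) : ZMod 8 :=
  ((q / 2 ^ padicValRat 2 q).num : ZMod 8) * ((q / 2 ^ padicValRat 2 q).den : ZMod 8)⁻¹

/-- The nonzero rational number `q = 2ᵏ u` is a 2-adic antisquare: `k` odd and `u ≡ ±3 mod 8`. -/
def IsAntisquare (q : ℚ) : Prop :=
  Odd (padicValRat 2 q) ∧ (oddPartModEight q = 3 ∨ oddPartModEight q = -3)

open Classical in
/-- The contribution to the oddity of a diagonal term `q`: its odd part, plus 4 if `q` is a
2-adic antisquare. -/
noncomputable def oddityTerm (q : ℚ) : ZMod 8 :=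
  oddPartModEight q + if IsAntisquare q then 4 else 0

/-- The rational lattice `L` has oddity `o` (modulo 8): if `L ⊗ ℚ` is diagonalised as
`diag(q₁, …, qₙ)` over `ℚ`, then `o` is the sum of the odd parts of the `qᵢ` plus 4 times the
number of 2-adic antisquares among them. (Every diagonalisation gives the same value.) -/
def HasOddity {n : ℕ} (L : Submodule ℤ (EuclideanSpace ℝ (Fin n))) (o : ZMod 8) : Prop :=
  ∃ (e : Fin n → EuclideanSpace ℝ (Fin n)) (q : Fin n → ℚ),
    (∀ i, e i ∈ ratSpan L) ∧ (∀ i, e i ≠ 0) ∧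
    (∀ i j, i ≠ j → inner ℝ (e i) (e j) = 0) ∧
    (∀ i, inner ℝ (e i) (e i) = (q i : ℝ)) ∧
    o = ∑ i, oddityTerm (q i)

end ModularLattice

/-!
# Even 2-modular lattices from odd ones

Everything happens at the prime 2. Put `A = L ⊗ ℤ_(2)` and let `D` be its dual; both are realised
inside `ℝⁿ` by `loc`, and a lattice is recovered from its localizations
(`mem_of_forall_mem_loc`). At odd primes the construction changes nothing but the scaling, and the
two factors `√2` combine to show that the twice derived lattice is the 2-dual of
`K = {x ∈ (A₀)* : x · x ∈ ℤ_(2)}` (`derived_derived_eq`). In particular it lies in `L ⊗ ℚ`, so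
rational equivalence is clear, and a similarity which preserves the local data of `L` preserves
those of `L''`.

A modularity of level 2 maps `D` onto `A`. Let `c ∈ A` and `c' ∈ D` be characteristic vectors,
`c · u ≡ u · u (mod 2)` on `A` and `c' · d ≡ d · d (mod 1)` on `D`. Then `(A₀)* = D ∪ (D + c/2)`,
and similarly `(D₀)* = A ∪ (A + c')` for `D₀ = {d ∈ D : d · d ∈ ℤ_(2)}`. With these descriptions a
direct computation with cosets (`LocalSetup`) gives all claims as soon as `c · c` is even and
`c · c + 2 c' · c' ≡ 2 c · c' (mod 4)`: the derived lattice is integral, `K*` is even, and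
`K* = {y ∈ (D₀)* : y · y ∈ 2 ℤ_(2)}`. The last set is the image of `K` under any similarity taking
`D` to `A`, so such a modularity maps the dual of `L''` at 2 onto `L''`
(`LocalSetup.inShadow_iff_inDerived_map`).

The congruence is where dimension and oddity enter (`exists_localSetup`). Modulo 4 the oddity of a
form of dimension divisible by 4 only records the odd part of the determinant modulo 4
(`oddPartModFour_prod_eq_one`), which is therefore 1. A Smith normal form of `L` in its image under
the inverse of the modularity gives a Gram matrix shaped like that of `f₁ ⊕ 2 f₂`, where both
constituents have dimension `n / 2`, an even number (`exists_adapted_basis`). For a unimodular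
symmetric form `f` of even dimension `2k`, subtracting the square of the functional `x ↦ c · x`
makes it even and multiplies its determinant by `1 - c · c`. Since an even unimodular form is a sum
of planes of determinant `-1` modulo 4, this gives `det f · (1 - c · c) ≡ (-1)ᵏ (mod 4)`
(`det_mul_one_sub_norm_char`). Multiplying these relations for `f₁` and for the complement of `f₁`,
with `c` and `c'` taken orthogonal modulo 4, yields the congruence.
-/

namespace ModularLattice

/-! ### Symmetric matrices over `ℤ/4` -/

/-- A symmetric matrix over `ℤ/4` with even diagonal and invertible determinant has even size `2k`
and determinant `(-1)ᵏ`: planes of determinant `-1` split off one after the other. -/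
theorem det_eq_neg_one_pow_of_even_diag {ι : Type*} [Fintype ι] [DecidableEq ι]
    (A : Matrix ι ι (ZMod 4)) (hs : A.IsSymm) (hd : ∀ i, 2 * A i i = 0) (hu : IsUnit A.det) :
    ∃ k, Fintype.card ι = 2 * k ∧ A.det = (-1) ^ k := by
  induction hn : Fintype.card ι using Nat.strong_induction_on generalizing ι with
  | _ n ih =>
  rcases isEmpty_or_nonempty ι with he | ⟨⟨i⟩⟩
  · exact ⟨0, by rw [← hn, Fintype.card_eq_zero], by simp⟩
  have hrow : ∃ j, 2 * A i j ≠ 0 := by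
    by_contra! h
    have h1 : Matrix.vecMul (Pi.single i 2) A = 0 := by
      ext j; simp [h j]
    have h2 : Matrix.vecMul (Matrix.vecMul (Pi.single i 2) A) A⁻¹ = Pi.single i 2 := by
      rw [Matrix.vecMul_vecMul, Matrix.mul_nonsing_inv _ hu, Matrix.vecMul_one]
    rw [h1, Matrix.zero_vecMul] at h2
    have h3 := congrFun h2 i
    simp only [Pi.zero_apply, Pi.single_eq_same] at h3
    exact absurd h3 (by decide)
  obtain ⟨j, hj⟩ := hrow
  have hij : i ≠ j := fun h => hj (h ▸ hd i)
  let f : Fin 2 ⊕ {x // x ≠ i ∧ x ≠ j} → ι := Sum.elim ![i, j] Subtype.val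
  have hf : Function.Bijective f := by
    constructor
    · rintro (x | x) (y | y) h
      · fin_cases x <;> fin_cases y <;> simp_all [f]
      · fin_cases x
        · exact absurd h.symm y.2.1
        · exact absurd h.symm y.2.2
      · fin_cases y
        · exact absurd h x.2.1
        · exact absurd h x.2.2
      · exact congrArg Sum.inr (Subtype.ext h)
    · intro x
      by_cases h1 : x = i
      · exact ⟨Sum.inl 0, h1.symm⟩
      by_cases h2 : x = j
      · exact ⟨Sum.inl 1, h2.symm⟩
      exact ⟨Sum.inr ⟨x, h1, h2⟩, rfl⟩
  let e := Equiv.ofBijective f hf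
  let P : Matrix (Fin 2) (Fin 2) (ZMod 4) := (A.submatrix e e).toBlocks₁₁
  let B := (A.submatrix e e).toBlocks₁₂
  let C := (A.submatrix e e).toBlocks₂₁
  let D := (A.submatrix e e).toBlocks₂₂
  have hP : P = !![A i i, A i j; A i j, A j j] := by
    ext x y
    fin_cases x <;> fin_cases y
    · rfl
    · rfl
    · exact hs.apply i j
    · rfl
  let P' : Matrix (Fin 2) (Fin 2) (ZMod 4) := !![-A j j, A i j; A i j, -A i i]
  have hi := hd i
  have hj' := hd j
  have key : ∀ a b d : ZMod 4, 2 * a = 0 → 2 * d = 0 → 2 * b ≠ 0 →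
      a * d = 0 ∧ b * b = 1 ∧ a * d - b * b = -1 := by decide
  obtain ⟨k1, k2, k3⟩ := key _ _ _ hi hj' hj
  have hPP' : P * P' = 1 := by
    rw [hP]
    ext x y
    fin_cases x <;> fin_cases y
    · simp [P', Matrix.mul_apply, k1, k2]
    · simp [P', Matrix.mul_apply]; ring
    · simp [P', Matrix.mul_apply]; ring
    · simp [P', Matrix.mul_apply, k2, mul_comm (A j j), k1]
  have hP'P : P' * P = 1 := mul_eq_one_comm.1 hPP'
  let _ : Invertible P := ⟨P', hP'P, hPP'⟩
  have hdet : A.det = P.det * (D - C * P' * B).det := by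
    rw [← Matrix.det_submatrix_equiv_self e A, ← Matrix.fromBlocks_toBlocks (A.submatrix e e)]
    exact Matrix.det_fromBlocks₁₁ P B C D
  have hPd : P.det = -1 := by rw [hP, Matrix.det_fin_two_of, k3]
  have hCB : C = B.transpose := by
    ext x y
    exact hs.apply _ _
  have hP's : P'.transpose = P' := by
    ext x y
    fin_cases x <;> fin_cases y <;> rfl
  have hDs : D.transpose = D := by
    ext x y
    exact hs.apply _ _
  have hcard : Fintype.card ι = 2 + Fintype.card {x // x ≠ i ∧ x ≠ j} := by
    rw [← Fintype.card_congr e, Fintype.card_sum, Fintype.card_fin]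
  obtain ⟨k, hk1, hk2⟩ := ih (Fintype.card {x // x ≠ i ∧ x ≠ j}) (by omega) (D - C * P' * B)
    (by
      rw [Matrix.IsSymm, Matrix.transpose_sub, Matrix.transpose_mul, Matrix.transpose_mul, hCB,
        hP's, hDs, Matrix.transpose_transpose, Matrix.mul_assoc])
    (by
      intro x
      have hx : 2 * D x x = 0 := hd _
      have h4 : (4 : ZMod 4) = 0 := by decide
      have : (C * P' * B) x x = B 0 x * (-A j j * B 0 x + A i j * B 1 x)
          + B 1 x * (A i j * B 0 x - A i i * B 1 x) := by
        rw [hCB]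
        simp [Matrix.mul_apply, P', Fin.sum_univ_two]
        ring
      rw [Matrix.sub_apply, this]
      linear_combination hx + (B 0 x) ^ 2 * hj' + (B 1 x) ^ 2 * hi - A i j * B 0 x * B 1 x * h4)
    (by
      rw [hdet] at hu
      exact isUnit_of_mul_isUnit_right hu) rfl
  refine ⟨k + 1, by omega, ?_⟩
  rw [hdet, hPd, hk2, pow_succ]; ring

/-- Matrix determinant lemma for a symmetric rank one perturbation, with `A x = v`. -/
theorem det_sub_vecMulVec {R ι : Type*} [CommRing R] [Fintype ι] [DecidableEq ι]
    (A : Matrix ι ι R) (hu : IsUnit A.det) (v x : ι → R) (hx : A.mulVec x = v) :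
    (A - Matrix.vecMulVec v v).det = A.det * (1 - v ⬝ᵥ x) := by
  have h1 : A - Matrix.vecMulVec v v
      = A + Matrix.replicateCol Unit (-v) * Matrix.replicateRow Unit v := by
    ext i j
    simp [Matrix.vecMulVec_apply, Matrix.mul_apply, sub_eq_add_neg]
  have hx' : A⁻¹.mulVec v = x := by
    rw [← hx, Matrix.mulVec_mulVec, Matrix.nonsing_inv_mul _ hu, Matrix.one_mulVec]
  rw [h1, Matrix.det_add_replicateCol_mul_replicateRow hu, Matrix.mul_assoc]
  congr 1
  rw [← Matrix.replicateCol_mulVec, Matrix.det_unique, Matrix.add_apply,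
    Matrix.replicateRow_mul_replicateCol_apply, Matrix.mulVec_neg, hx', dotProduct_neg,
    Matrix.one_apply_eq, sub_eq_add_neg]

/-- The mod 4 form of van der Blij's lemma: the norm `t = vᵀ A⁻¹ v` of the characteristic vector
of a unimodular symmetric matrix of even size `2k` is even and determines `det A` modulo 4. -/
theorem det_mul_one_sub_norm_char {ι : Type*} [Fintype ι] [DecidableEq ι]
    (A : Matrix ι ι (ZMod 4)) (hs : A.IsSymm) (hu : IsUnit A.det) (x : ι → ZMod 4)
    (hx : A.mulVec x = A.diag) (k : ℕ) (hk : Fintype.card ι = 2 * k) :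
    2 * (A.diag ⬝ᵥ x) = 0 ∧ A.det * (1 - A.diag ⬝ᵥ x) = (-1) ^ k := by
  have hev : ∀ a : ZMod 4, 2 * (a - a * a) = 0 := by decide
  have hnu : ∀ a : ZMod 4, ¬ IsUnit a → 2 * a = 0 := by decide
  have h2 : ∀ a : ZMod 4, 2 * a = 0 → IsUnit (1 - a) := by decide
  have ht : 2 * (A.diag ⬝ᵥ x) = 0 := by
    apply hnu
    intro hunit
    -- The unimodular form `A ⊕ ⟨1⟩` has odd size, so its even perturbation is degenerate.
    let A' : Matrix (ι ⊕ Unit) (ι ⊕ Unit) (ZMod 4) := Matrix.fromBlocks A 0 0 1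
    have hA'det : A'.det = A.det := by simp [A']
    have hA's : A'.IsSymm := Matrix.IsSymm.fromBlocks hs (by simp) Matrix.isSymm_one
    have hx' : A'.mulVec (Sum.elim x 1) = A'.diag := by
      rw [Matrix.fromBlocks_mulVec]
      ext (i | i)
      · simpa [A'] using congrFun hx i
      · simp [A']
    have hdet := det_sub_vecMulVec A' (by rwa [hA'det]) _ _ hx'
    have hdot : A'.diag ⬝ᵥ Sum.elim x 1 = A.diag ⬝ᵥ x + 1 := by
      simp [dotProduct, A', Matrix.diag]
    obtain ⟨l, hl, -⟩ := det_eq_neg_one_pow_of_even_diag (A' - Matrix.vecMulVec A'.diag A'.diag)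
      (by
        ext i j
        simp only [Matrix.transpose_apply, Matrix.sub_apply, Matrix.vecMulVec_apply, hA's.apply i j]
        ring)
      (fun i => hev _)
      (by
        rw [hdet, hdot, hA'det, sub_add_cancel_right]
        exact hu.mul hunit.neg)
    rw [Fintype.card_sum, Fintype.card_unit] at hl
    omega
  refine ⟨ht, ?_⟩
  have hdet := det_sub_vecMulVec A hu _ _ hx
  obtain ⟨l, hl, hl'⟩ := det_eq_neg_one_pow_of_even_diag (A - Matrix.vecMulVec A.diag A.diag)
    (by
      ext i j
      simp only [Matrix.transpose_apply, Matrix.sub_apply, Matrix.vecMulVec_apply, hs.apply i j]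
      ring)
    (fun i => hev _)
    (by rw [hdet]; exact hu.mul (h2 _ ht))
  rw [← hdet, hl']
  congr 1
  omega

/-- Matrix form of the key congruence. `E` has the shape of the pairing of a lattice
`f₁ ⊕ 2 f₂` with its dual; `x` gives a characteristic vector `c` of the first constituent and
`(y, z)` a vector `c'` orthogonal to it which is characteristic for the dual lattice. If `det E = 1`
modulo 4, then the norms satisfy `c·c + 2 c'·c' ≡ 0` modulo 4. -/
theorem exists_char_vectors_of_det_eq_one {ι κ : Type*} [Fintype ι] [DecidableEq ι] [Fintype κ]
    [DecidableEq κ] (P : Matrix ι ι (ZMod 4)) (Q : Matrix ι κ (ZMod 4)) (R : Matrix κ κ (ZMod 4))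
    (hP : P.IsSymm) (hR : R.IsSymm)
    (hE : (Matrix.fromBlocks P Q ((2 : ZMod 4) • Q.transpose) R).det = 1)
    (k l : ℕ) (hk : Fintype.card ι = 2 * k) (hl : Fintype.card κ = 2 * l) (hkl : Even (k + l)) :
    ∃ (x y : ι → ZMod 4) (z : κ → ZMod 4), P.mulVec x = P.diag ∧ P.mulVec y + Q.mulVec z = 0 ∧
      (∀ j, 2 * (((2 : ZMod 4) • Q.transpose.mulVec y + R.mulVec z) j - R j j) = 0) ∧
      2 * (P.diag ⬝ᵥ x) = 0 ∧
      P.diag ⬝ᵥ x + z ⬝ᵥ ((2 : ZMod 4) • Q.transpose.mulVec y + R.mulVec z) = 0 := by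
  have h4 : (2 : ZMod 4) * 2 = 0 := by decide
  have hPu : IsUnit P.det := by
    -- Modulo 2 the matrix `E` is block triangular.
    let φ := ZMod.castHom (show 2 ∣ 4 by norm_num) (ZMod 2)
    have h1 : φ P.det * φ R.det = 1 := by
      have := congrArg φ hE
      rw [RingHom.map_det, RingHom.mapMatrix_apply, Matrix.fromBlocks_map] at this
      have h0 : ((2 : ZMod 4) • Q.transpose).map φ = 0 := by
        ext i j
        have h2 : φ 2 = 0 := by decide
        simp [h2]
      rw [h0, Matrix.det_fromBlocks_zero₂₁, map_one] at this
      rwa [RingHom.map_det, RingHom.map_det]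
    have h2 : ∀ a : ZMod 4, φ a ≠ 0 → IsUnit a := by decide
    exact h2 _ (left_ne_zero_of_mul (h1.trans_ne one_ne_zero))
  let _ : Invertible P := P.invertibleOfIsUnitDet hPu
  have hPi : P * P⁻¹ = 1 := Matrix.mul_nonsing_inv _ hPu
  have hPis : (P⁻¹).transpose = P⁻¹ := by rw [Matrix.transpose_nonsing_inv, hP]
  let S := R - ((2 : ZMod 4) • Q.transpose) * ⅟P * Q
  have hSdet : P.det * S.det = 1 := by rw [← hE, Matrix.det_fromBlocks₁₁]
  have hSu : IsUnit S.det := IsUnit.of_mul_eq_one_right _ hSdet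
  have hSS : S = R - (2 : ZMod 4) • (Q.transpose * P⁻¹ * Q) := by
    simp only [S, Matrix.invOf_eq_nonsing_inv, Matrix.smul_mul]
  have hSs : S.IsSymm := by
    rw [hSS, Matrix.IsSymm, Matrix.transpose_sub, Matrix.transpose_smul, Matrix.transpose_mul,
      Matrix.transpose_mul, Matrix.transpose_transpose, hPis, hR, Matrix.mul_assoc]
  let x := P⁻¹.mulVec P.diag
  let z := S⁻¹.mulVec S.diag
  let y := -(P⁻¹.mulVec (Q.mulVec z))
  have hx : P.mulVec x = P.diag := by rw [Matrix.mulVec_mulVec, hPi, Matrix.one_mulVec]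
  have hz : S.mulVec z = S.diag := by
    rw [Matrix.mulVec_mulVec, Matrix.mul_nonsing_inv _ hSu, Matrix.one_mulVec]
  have hs : (2 : ZMod 4) • Q.transpose.mulVec y + R.mulVec z = S.diag := by
    rw [← hz, hSS, Matrix.sub_mulVec, Matrix.smul_mulVec, Matrix.mulVec_neg, ← Matrix.mulVec_mulVec,
      ← Matrix.mulVec_mulVec, smul_neg]
    abel
  obtain ⟨p1, p2⟩ := det_mul_one_sub_norm_char P hP hPu x hx k hk
  obtain ⟨s1, s2⟩ := det_mul_one_sub_norm_char S hSs hSu z hz l hl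
  refine ⟨x, y, z, hx, ?_, ?_, p1, ?_⟩
  · rw [Matrix.mulVec_neg, Matrix.mulVec_mulVec, hPi, Matrix.one_mulVec, neg_add_cancel]
  · intro j
    rw [hs, hSS, Matrix.diag_apply, Matrix.sub_apply, Matrix.smul_apply, smul_eq_mul]
    linear_combination (-(Q.transpose * P⁻¹ * Q) j j) * h4
  · rw [hs, dotProduct_comm z]
    have h5 : (1 - P.diag ⬝ᵥ x) * (1 - S.diag ⬝ᵥ z) = 1 := by
      have := congrArg₂ (· * ·) p2 s2
      simp only [← pow_add, hkl.neg_one_pow] at this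
      linear_combination this - (1 - P.diag ⬝ᵥ x) * (1 - S.diag ⬝ᵥ z) * hSdet
    have h6 : ∀ a b : ZMod 4, 2 * a = 0 → 2 * b = 0 → (1 - a) * (1 - b) = 1 → a + b = 0 := by decide
    exact h6 _ _ p1 s1 h5

/-! ### The oddity modulo 4 -/

/-- The odd part `u` of a nonzero rational number `2ᵏ u`, modulo 4. -/
def oddPartModFour (q : ℚ) : ZMod 4 :=
  ZMod.castHom (show 4 ∣ 8 by norm_num) (ZMod 4) (oddPartModEight q)

theorem exists_eq_two_zpow_mul_odd {q : ℚ} (hq : q ≠ 0) :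
    ∃ (k : ℤ) (a b : ℤ), Odd a ∧ Odd b ∧ q = 2 ^ k * (a / b) := by
  have hint : ∀ m : ℤ, m ≠ 0 → ∃ (k : ℕ) (a : ℤ), Odd a ∧ m = 2 ^ k * a := by
    intro m hm
    obtain ⟨k, a, ha, h⟩ := Nat.exists_eq_two_pow_mul_odd (Int.natAbs_ne_zero.2 hm)
    refine ⟨k, m.sign * a, Odd.mul ?_ (by exact_mod_cast ha), ?_⟩
    · rcases lt_or_gt_of_ne hm with h | h
      · rw [Int.sign_eq_neg_one_of_neg h]; decide
      · rw [Int.sign_eq_one_of_pos h]; decide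
    · conv_lhs => rw [← Int.sign_mul_natAbs m, h]
      push_cast; ring
  obtain ⟨k, a, ha, h1⟩ := hint q.num (Rat.num_ne_zero.2 hq)
  obtain ⟨l, b, hb, h2⟩ := hint q.den (by exact_mod_cast q.den_ne_zero)
  refine ⟨(k : ℤ) - l, a, b, ha, hb, ?_⟩
  have hb0 : (b : ℚ) ≠ 0 := by
    rintro h
    rw [Int.cast_eq_zero] at h
    subst h
    exact absurd hb (by decide)
  have h3 : (q.num : ℚ) = 2 ^ k * a := by exact_mod_cast h1
  have h4 : (q.den : ℚ) = 2 ^ l * b := by exact_mod_cast h2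
  rw [← Rat.num_div_den q, h3, h4, zpow_sub₀ two_ne_zero, zpow_natCast, zpow_natCast]
  field_simp

theorem oddPartModFour_mul_eq {q : ℚ} {k a b : ℤ} (ha : Odd a) (hb : Odd b)
    (hq : q = 2 ^ k * (a / b)) : oddPartModFour q * b = a := by
  have hne : ∀ {c : ℤ}, Odd c → c ≠ 0 := by
    rintro c hc rfl
    exact absurd hc (by decide)
  have ha0 : (a : ℚ) ≠ 0 := by exact_mod_cast hne ha
  have hb0 : (b : ℚ) ≠ 0 := by exact_mod_cast hne hb
  have hval : ∀ {c : ℤ}, Odd c → padicValRat 2 (c : ℚ) = 0 := by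
    intro c hc
    rw [padicValRat.of_int, padicValInt.eq_zero_of_not_dvd]
    · rfl
    · rw [← Int.not_even_iff_odd, even_iff_two_dvd] at hc
      exact_mod_cast hc
  have hv : padicValRat 2 q = k := by
    rw [hq, padicValRat.mul (zpow_ne_zero _ two_ne_zero) (div_ne_zero ha0 hb0),
      padicValRat.div ha0 hb0, hval ha, hval hb]
    have : padicValRat 2 ((2 : ℚ) ^ k) = k := by
      have h2 : padicValRat 2 (2 : ℚ) = 1 := padicValRat.self one_lt_two
      rw [padicValRat.zpow, h2, mul_one]
    rw [this]; simp
  have hr : q / 2 ^ padicValRat 2 q = a / b := by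
    rw [hv, hq]
    field_simp
  rw [oddPartModFour, oddPartModEight, hr]
  have hcross : ((a : ℚ) / b).num * b = a * ((a : ℚ) / b).den := by
    have h1 : (((a : ℚ) / b).num : ℚ) / ((a : ℚ) / b).den = a / b := Rat.num_div_den _
    have h2 : (((a : ℚ) / b).den : ℚ) ≠ 0 := by exact_mod_cast Rat.den_ne_zero _
    rw [div_eq_div_iff h2 hb0] at h1
    exact_mod_cast h1
  have hden : IsUnit ((((a : ℚ) / b).den : ℕ) : ZMod 8) := by
    rw [ZMod.isUnit_iff_coprime]
    refine Nat.Coprime.pow_right 3 (m := 2) ?_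
    rw [Nat.coprime_two_right]
    have h1 : (((a : ℚ) / b).den : ℤ) ∣ b := by
      simpa only [Rat.divInt_eq_div] using Rat.den_dvd a b
    have h2 : Odd ((((a : ℚ) / b).den : ℕ) : ℤ) := by
      obtain ⟨c, hc⟩ := h1
      rw [hc] at hb
      exact (Int.odd_mul.1 hb).1
    exact_mod_cast h2
  set d := ((a : ℚ) / b).den
  set m := ((a : ℚ) / b).num
  have h8 : ((m : ZMod 8) * (d : ZMod 8)⁻¹) * b = a := by
    have h1 : (m : ZMod 8) * b = a * d := by exact_mod_cast congrArg (Int.cast : ℤ → ZMod 8) hcross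
    calc _ = (m : ZMod 8) * b * (d : ZMod 8)⁻¹ := by ring
      _ = _ := by rw [h1, mul_assoc, ZMod.mul_inv_of_unit _ hden, mul_one]
  have := congrArg (ZMod.castHom (show 4 ∣ 8 by norm_num) (ZMod 4)) h8
  simpa only [map_mul, map_intCast] using this

theorem intCast_mul_self_of_odd {a : ℤ} (ha : Odd a) : (a : ZMod 4) * a = 1 := by
  obtain ⟨k, rfl⟩ := ha
  push_cast
  generalize (k : ZMod 4) = x
  revert x
  decide

theorem oddPartModFour_eq {q : ℚ} {k a b : ℤ} (ha : Odd a) (hb : Odd b)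
    (hq : q = 2 ^ k * (a / b)) : oddPartModFour q = a * b := by
  linear_combination (b : ZMod 4) * oddPartModFour_mul_eq ha hb hq
    - oddPartModFour q * intCast_mul_self_of_odd hb

theorem oddPartModFour_two_pow_mul {a : ℤ} (ha : Odd a) (k : ℕ) :
    oddPartModFour (2 ^ k * a) = a := by
  simpa using oddPartModFour_eq (q := 2 ^ k * a) (k := k) ha odd_one (by simp)

theorem oddPartModFour_mul {p q : ℚ} (hp : p ≠ 0) (hq : q ≠ 0) :
    oddPartModFour (p * q) = oddPartModFour p * oddPartModFour q := by
  obtain ⟨k, a, b, ha, hb, rfl⟩ := exists_eq_two_zpow_mul_odd hp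
  obtain ⟨l, c, d, hc, hd, rfl⟩ := exists_eq_two_zpow_mul_odd hq
  rw [oddPartModFour_eq ha hb rfl, oddPartModFour_eq hc hd rfl,
    oddPartModFour_eq (k := k + l) (ha.mul hc) (hb.mul hd)]
  · push_cast; ring
  · rw [zpow_add₀ two_ne_zero]; push_cast
    rw [← div_mul_div_comm]; ring

theorem oddPartModFour_mul_self {q : ℚ} (hq : q ≠ 0) :
    oddPartModFour q * oddPartModFour q = 1 := by
  obtain ⟨k, a, b, ha, hb, rfl⟩ := exists_eq_two_zpow_mul_odd hq
  rw [oddPartModFour_eq ha hb rfl]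
  linear_combination (b * b : ZMod 4) * intCast_mul_self_of_odd ha + intCast_mul_self_of_odd hb

theorem castHom_oddityTerm (q : ℚ) :
    ZMod.castHom (show 4 ∣ 8 by norm_num) (ZMod 4) (oddityTerm q) = oddPartModFour q := by
  rw [oddityTerm, map_add, oddPartModFour]
  split_ifs
  · have : ZMod.castHom (show 4 ∣ 8 by norm_num) (ZMod 4) 4 = 0 := by decide
    rw [this, add_zero]
  · rw [map_zero, add_zero]

/-- Modulo 4, a sum of odd residues is determined by their number and their product. Hence the
oddity modulo 4 only depends on the dimension and the determinant. -/
theorem sum_oddPartModFour {ι : Type*} (s : Finset ι) (q : ι → ℚ) (hq : ∀ i, q i ≠ 0) :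
    ∑ i ∈ s, oddPartModFour (q i) = s.card + (oddPartModFour (∏ i ∈ s, q i) - 1) := by
  classical
  have key : ∀ a b : ZMod 4, a * a = 1 → b * b = 1 → a + (b - 1) = 1 + (a * b - 1) := by decide
  induction s using Finset.induction_on with
  | empty =>
    have : oddPartModFour 1 = 1 := by simpa using oddPartModFour_two_pow_mul odd_one 0
    simp [this]
  | insert i s hi ih =>
    have hs : ∏ j ∈ s, q j ≠ 0 := Finset.prod_ne_zero_iff.2 fun j _ => hq j
    rw [Finset.sum_insert hi, ih, Finset.prod_insert hi, Finset.card_insert_of_notMem hi,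
      oddPartModFour_mul (hq i) hs]
    push_cast
    linear_combination key _ _ (oddPartModFour_mul_self (hq i)) (oddPartModFour_mul_self hs)

theorem oddPartModFour_prod_eq_one {n : ℕ} (hn : 4 ∣ n) (q : Fin n → ℚ) (hq : ∀ i, q i ≠ 0)
    (ho : ∑ i, oddityTerm (q i) = 0 ∨ ∑ i, oddityTerm (q i) = 4) :
    oddPartModFour (∏ i, q i) = 1 := by
  have h1 : ∑ i, oddPartModFour (q i) = 0 := by
    simp_rw [← castHom_oddityTerm, ← map_sum]
    rcases ho with h | h <;> rw [h] <;> decide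
  have h2 : ((n : ℕ) : ZMod 4) = 0 := (ZMod.natCast_eq_zero_iff n 4).2 hn
  rw [sum_oddPartModFour _ q hq, Finset.card_univ, Fintype.card_fin, h2] at h1
  linear_combination h1

/-! ### Rational numbers integral at a prime -/

theorem IsPInt.mul {p : ℕ} (hp : p.Prime) {x y : ℝ} (hx : IsPInt p x) (hy : IsPInt p y) :
    IsPInt p (x * y) := by
  obtain ⟨a, rfl, ha⟩ := hx
  obtain ⟨b, rfl, hb⟩ := hy
  refine ⟨a * b, by push_cast; ring, fun h => ?_⟩
  rcases (hp.dvd_mul).1 (h.trans (Rat.mul_den_dvd a b)) with h | h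
  · exact ha h
  · exact hb h

theorem IsPInt.intCast {p : ℕ} (hp : p.Prime) (k : ℤ) : IsPInt p k :=
  ⟨k, by simp, by simpa using hp.ne_one⟩

/-- The local ring `ℤ_(p) = ℤ_p ∩ ℚ`, as a subring of `ℝ`. -/
def pIntegers (p : ℕ) (hp : p.Prime) : Subring ℝ where
  carrier := {x | IsPInt p x}
  mul_mem' := IsPInt.mul hp
  one_mem' := by simpa using IsPInt.intCast hp 1
  add_mem' := IsPInt.add hp
  zero_mem' := IsPInt.zero hp
  neg_mem' := fun {x} hx => by simpa using IsPInt.int_mul (-1) hx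

theorem isPInt_iff_exists_nat_mul {p : ℕ} {x : ℝ} :
    IsPInt p x ↔ ∃ k : ℕ, ¬ p ∣ k ∧ ∃ m : ℤ, (k : ℝ) * x = m := by
  constructor
  · rintro ⟨q, rfl, hq⟩
    refine ⟨q.den, hq, q.num, ?_⟩
    exact_mod_cast Rat.den_mul_eq_num q
  · rintro ⟨k, hk, m, h⟩
    have hk0 : (k : ℝ) ≠ 0 := by
      rintro h0
      rw [Nat.cast_eq_zero] at h0
      exact hk (h0 ▸ dvd_zero p)
    refine ⟨m / k, by push_cast; rw [← h]; field_simp, fun hd => hk ?_⟩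
    have h1 : (((m : ℚ) / (k : ℤ)).den : ℤ) ∣ k := by
      simpa only [Rat.divInt_eq_div] using Rat.den_dvd m k
    rw [Int.cast_natCast] at h1
    exact hd.trans (Int.natCast_dvd_natCast.1 h1)

theorem IsPInt.of_nat_mul {p : ℕ} (hp : p.Prime) {x : ℝ} {k : ℕ} (hk : ¬ p ∣ k)
    (h : IsPInt p (k * x)) : IsPInt p x := by
  rw [isPInt_iff_exists_nat_mul] at h ⊢
  obtain ⟨l, hl, m, h⟩ := h
  exact ⟨l * k, fun hd => ((hp.dvd_mul).1 hd).elim hl hk, m, by push_cast; rw [← h, mul_assoc]⟩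

/-- A rational number that is integral at every prime is an integer. -/
theorem exists_int_eq_of_forall_isPInt {x : ℝ} (h : ∀ p : ℕ, p.Prime → IsPInt p x) :
    ∃ k : ℤ, x = k := by
  obtain ⟨q, rfl, -⟩ := h 2 Nat.prime_two
  refine ⟨q.num, ?_⟩
  have hden : q.den = 1 := by
    by_contra hne
    obtain ⟨p, hp, hd⟩ := Nat.exists_prime_and_dvd hne
    obtain ⟨r, hr, hr'⟩ := h p hp
    rw [Rat.cast_inj.1 hr] at hr'
    exact hr' hd
  have := Rat.den_mul_eq_num q
  rw [hden] at this
  exact_mod_cast (by simpa using this : q = q.num)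

/-- The residue field of `ℤ_(2)` has two elements. -/
theorem IsPInt.half_or {x : ℝ} (hx : IsPInt 2 x) : IsPInt 2 (x / 2) ∨ IsPInt 2 ((x - 1) / 2) := by
  obtain ⟨k, hk, m, h⟩ := isPInt_iff_exists_nat_mul.1 hx
  have hk' : Odd k := by rwa [← Nat.not_even_iff_odd, even_iff_two_dvd]
  rcases Int.even_or_odd m with ⟨l, hl⟩ | ⟨l, hl⟩
  · left
    refine isPInt_iff_exists_nat_mul.2 ⟨k, hk, l, ?_⟩
    rw [hl] at h
    push_cast at h
    linear_combination h / 2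
  · right
    obtain ⟨j, hj⟩ := hk'
    refine isPInt_iff_exists_nat_mul.2 ⟨k, hk, l - j, ?_⟩
    rw [hl] at h
    have hj' : (k : ℝ) = 2 * j + 1 := by exact_mod_cast hj
    push_cast at h ⊢
    linear_combination h / 2 - hj' / 2

/-- The ring `ℤ_(2)`. -/
abbrev twoIntegers : Subring ℝ := pIntegers 2 Nat.prime_two

theorem int_mul_mem (k : ℤ) {x : ℝ} (hx : x ∈ twoIntegers) : (k : ℝ) * x ∈ twoIntegers :=
  IsPInt.int_mul k hx

theorem two_mul_mem {x : ℝ} (hx : x ∈ twoIntegers) : 2 * x ∈ twoIntegers := by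
  simpa using int_mul_mem 2 hx

theorem half_or_of_mem {x : ℝ} (hx : x ∈ twoIntegers) :
    x / 2 ∈ twoIntegers ∨ (x - 1) / 2 ∈ twoIntegers := IsPInt.half_or hx

/-! ### The construction at the prime 2 -/

section Local

variable {V : Type*} [NormedAddCommGroup V] [InnerProductSpace ℝ V]

local notation "⟪" x ", " y "⟫" => inner ℝ x y

/-- The situation at the prime 2: `A` is an odd `ℤ_(2)`-lattice with dual `D`, such that `D`
rescaled by `√2` is integral as well; `c` is a characteristic vector of `A` and `c'` one of `D`
(for the rescaled form), and they satisfy the congruence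
`c·c + 2 c'·c' - 2 c·c' ≡ 0` modulo 4 that encodes the condition on the oddity. -/
structure LocalSetup (A D : Submodule ℤ V) (c c' : V) : Prop where
  mem_dual : ∀ x, x ∈ D ↔ ∀ u ∈ A, ⟪x, u⟫ ∈ twoIntegers
  mem_iff : ∀ x, x ∈ A ↔ ∀ u ∈ D, ⟪x, u⟫ ∈ twoIntegers
  le : A ≤ D
  two_mul : ∀ d ∈ D, ∀ e ∈ D, 2 * ⟪d, e⟫ ∈ twoIntegers
  char_mem : c ∈ A
  char_mem' : c' ∈ D
  char : ∀ u ∈ A, (⟪u, u⟫ - ⟪c, u⟫) / 2 ∈ twoIntegers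
  char' : ∀ d ∈ D, ⟪d, d⟫ - ⟪c', d⟫ ∈ twoIntegers
  norm_even : ⟪c, c⟫ / 2 ∈ twoIntegers
  key : (⟪c, c⟫ / 2 + ⟪c', c'⟫ - ⟪c, c'⟫) / 2 ∈ twoIntegers
  odd : ∃ u ∈ A, ⟪u, u⟫ / 2 ∉ twoIntegers
  odd' : ∃ d ∈ D, ⟪d, d⟫ ∉ twoIntegers

/-- Membership in the dual of the even sublattice of `A`. -/
def InEvenDual (A : Submodule ℤ V) (x : V) : Prop :=
  ∀ u ∈ A, ⟪u, u⟫ / 2 ∈ twoIntegers → ⟪x, u⟫ ∈ twoIntegers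

/-- Membership in the sublattice of vectors of integral norm in the dual of the even sublattice
of `A`: up to the factor `√2` this is the even sublattice of the derived lattice. -/
def InShadow (A : Submodule ℤ V) (x : V) : Prop :=
  InEvenDual A x ∧ ⟪x, x⟫ ∈ twoIntegers

/-- Membership in the dual of the lattice described by `InShadow`, that is in the lattice
derived twice from `A`. -/
def InDerived (A : Submodule ℤ V) (y : V) : Prop :=
  ∀ x, InShadow A x → ⟪y, x⟫ ∈ twoIntegers

/-- The analogue of `InShadow` for the dual lattice `D` with its form multiplied by 2, up to
a factor 2 in the vectors. -/
def InDualShadow (D : Submodule ℤ V) (y : V) : Prop :=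
  (∀ d ∈ D, ⟪d, d⟫ ∈ twoIntegers → ⟪y, d⟫ ∈ twoIntegers) ∧ ⟪y, y⟫ / 2 ∈ twoIntegers

namespace LocalSetup

variable {A D : Submodule ℤ V} {c c' : V} (h : LocalSetup A D c c')

include h

theorem inner_mem {x u : V} (hx : x ∈ D) (hu : u ∈ A) : ⟪x, u⟫ ∈ twoIntegers :=
  (h.mem_dual x).1 hx u hu

theorem inner_mem' {x u : V} (hx : x ∈ A) (hu : u ∈ D) : ⟪x, u⟫ ∈ twoIntegers :=
  (h.mem_iff x).1 hx u hu

theorem inEvenDual_of_mem {x : V} (hx : x ∈ D) : InEvenDual A x :=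
  fun _ hu _ => h.inner_mem hx hu

theorem inEvenDual_add {d : V} (hd : d ∈ D) : InEvenDual A (d + (1 / 2 : ℝ) • c) := by
  intro u hu hev
  convert sub_mem (add_mem (h.inner_mem hd hu) hev) (h.char u hu) using 1
  rw [inner_add_left, real_inner_smul_left]
  ring

/-- The dual of the even sublattice is `D ∪ (D + c/2)`. -/
theorem mem_or_of_inEvenDual {x : V} (hx : InEvenDual A x) :
    x ∈ D ∨ x - (1 / 2 : ℝ) • c ∈ D := by
  obtain ⟨v, hv, hodd⟩ := h.odd
  have hvv : (⟪v, v⟫ - 1) / 2 ∈ twoIntegers :=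
    (half_or_of_mem (h.inner_mem (h.le hv) hv)).resolve_left hodd
  have hsub : ∀ u ∈ A, ⟪u, u⟫ / 2 ∉ twoIntegers → ⟪x, u - v⟫ ∈ twoIntegers := by
    intro u hu hnu
    have huu : (⟪u, u⟫ - 1) / 2 ∈ twoIntegers :=
      (half_or_of_mem (h.inner_mem (h.le hu) hu)).resolve_left hnu
    refine hx _ (sub_mem hu hv) ?_
    convert add_mem (sub_mem (add_mem huu hvv) (h.inner_mem (h.le hu) hv)) (one_mem twoIntegers)
      using 1
    rw [real_inner_sub_sub_self]
    ring
  have h2v : 2 * ⟪x, v⟫ ∈ twoIntegers := by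
    convert hx ((2 : ℤ) • v) (A.smul_mem 2 hv) ?_ using 1
    · rw [← Int.cast_smul_eq_zsmul ℝ, real_inner_smul_right]; norm_num
    · convert two_mul_mem (h.inner_mem (h.le hv) hv) using 1
      rw [← Int.cast_smul_eq_zsmul ℝ, real_inner_smul_right, real_inner_smul_left]
      push_cast; ring
  rcases half_or_of_mem h2v with h1 | h1
  · left
    rw [h.mem_dual]
    intro u hu
    by_cases hev : ⟪u, u⟫ / 2 ∈ twoIntegers
    · exact hx u hu hev
    · convert add_mem (hsub u hu hev) h1 using 1
      rw [inner_sub_right]; ring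
  · right
    rw [h.mem_dual]
    intro u hu
    by_cases hev : ⟪u, u⟫ / 2 ∈ twoIntegers
    · convert add_mem (sub_mem (hx u hu hev) hev) (h.char u hu) using 1
      rw [inner_sub_left, real_inner_smul_left]; ring
    · have huu : (⟪u, u⟫ - 1) / 2 ∈ twoIntegers :=
        (half_or_of_mem (h.inner_mem (h.le hu) hu)).resolve_left hev
      convert add_mem (sub_mem (add_mem (hsub u hu hev) h1) huu) (h.char u hu) using 1
      rw [inner_sub_left, real_inner_smul_left, inner_sub_right]; ring

/-- The dual of the even sublattice of `D` is `A ∪ (A + c')`. -/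
theorem mem_or_of_inner_mem {y : V} (hy : ∀ d ∈ D, ⟪d, d⟫ ∈ twoIntegers → ⟪y, d⟫ ∈ twoIntegers) :
    y ∈ A ∨ y - c' ∈ A := by
  obtain ⟨v, hv, hodd⟩ := h.odd'
  have hhalf : ∀ d ∈ D, ⟪d, d⟫ ∉ twoIntegers → ⟪d, d⟫ - 1 / 2 ∈ twoIntegers := by
    intro d hd hnd
    rcases half_or_of_mem (h.two_mul d hd d hd) with h1 | h1
    · exact absurd (by convert h1 using 1; ring) hnd
    · convert h1 using 1; ring
  have hvv := hhalf v hv hodd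
  have hsub : ∀ u ∈ D, ⟪u, u⟫ ∉ twoIntegers → ⟪y, u - v⟫ ∈ twoIntegers := by
    intro u hu hnu
    have huu := hhalf u hu hnu
    refine hy _ (sub_mem hu hv) ?_
    convert add_mem (sub_mem (add_mem huu hvv) (h.two_mul u hu v hv)) (one_mem twoIntegers)
      using 1
    rw [real_inner_sub_sub_self]
    ring
  have h2v : 2 * ⟪y, v⟫ ∈ twoIntegers := by
    convert hy ((2 : ℤ) • v) (D.smul_mem 2 hv) ?_ using 1
    · rw [← Int.cast_smul_eq_zsmul ℝ, real_inner_smul_right]; norm_num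
    · convert two_mul_mem (h.two_mul v hv v hv) using 1
      rw [← Int.cast_smul_eq_zsmul ℝ, real_inner_smul_right, real_inner_smul_left]
      push_cast; ring
  rcases half_or_of_mem h2v with h1 | h1
  · left
    rw [h.mem_iff]
    intro u hu
    by_cases hev : ⟪u, u⟫ ∈ twoIntegers
    · exact hy u hu hev
    · convert add_mem (hsub u hu hev) h1 using 1
      rw [inner_sub_right]; ring
  · right
    rw [h.mem_iff]
    intro u hu
    by_cases hev : ⟪u, u⟫ ∈ twoIntegers
    · convert add_mem (sub_mem (hy u hu hev) hev) (h.char' u hu) using 1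
      rw [inner_sub_left]; ring
    · have huu := hhalf u hu hev
      convert add_mem (sub_mem (add_mem (hsub u hu hev) h1) huu) (h.char' u hu) using 1
      rw [inner_sub_left, inner_sub_right]; ring

/-- The derived lattice is integral at 2. -/
theorem two_mul_inner_mem {x y : V} (hx : InEvenDual A x) (hy : InEvenDual A y) :
    2 * ⟪x, y⟫ ∈ twoIntegers := by
  rcases h.mem_or_of_inEvenDual hx with hx | hx <;> rcases h.mem_or_of_inEvenDual hy with hy | hy
  · exact h.two_mul x hx y hy
  · convert add_mem (h.two_mul _ hx _ hy) (h.inner_mem hx h.char_mem) using 1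
    rw [inner_sub_right, real_inner_smul_right]; ring
  · convert add_mem (h.two_mul _ hx _ hy) (h.inner_mem hy h.char_mem) using 1
    rw [inner_sub_left, real_inner_smul_left, real_inner_comm y c]; ring
  · convert add_mem (add_mem (h.two_mul _ hx _ hy) (h.inner_mem hx h.char_mem))
      (add_mem (h.inner_mem hy h.char_mem) h.norm_even) using 1
    simp only [inner_sub_left, inner_sub_right, real_inner_smul_left, real_inner_smul_right,
      real_inner_comm y c]
    ring

theorem inShadow_of_mem {d : V} (hd : d ∈ D) (hdd : ⟪d, d⟫ ∈ twoIntegers) : InShadow A d :=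
  ⟨h.inEvenDual_of_mem hd, hdd⟩

theorem mem_or_of_inDerived {y : V} (hy : InDerived A y) : y ∈ A ∨ y - c' ∈ A :=
  h.mem_or_of_inner_mem fun _ hd hdd => hy _ (h.inShadow_of_mem hd hdd)

/-- The nontrivial coset of `D` in the dual of the even sublattice of `A` contains vectors of
integral norm. -/
theorem exists_inShadow_add : ∃ d ∈ D, InShadow A (d + (1 / 2 : ℝ) • c) := by
  rcases half_or_of_mem h.norm_even with h1 | h1
  · refine ⟨0, zero_mem _, h.inEvenDual_add (zero_mem _), ?_⟩
    convert h1 using 1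
    rw [zero_add, real_inner_smul_left, real_inner_smul_right]; ring
  · obtain ⟨d, hd, hodd⟩ := h.odd'
    refine ⟨d, hd, h.inEvenDual_add hd, ?_⟩
    rcases half_or_of_mem (h.two_mul d hd d hd) with h2 | h2
    · exact absurd (by convert h2 using 1; ring) hodd
    · convert add_mem (add_mem (add_mem h1 h2) (h.inner_mem hd h.char_mem)) (one_mem _) using 1
      simp only [inner_add_left, inner_add_right, real_inner_smul_left, real_inner_smul_right,
        real_inner_comm d c]
      ring

/-- The twice derived lattice is even at 2. -/
theorem norm_even_of_inDerived {y : V} (hy : InDerived A y) : ⟪y, y⟫ / 2 ∈ twoIntegers := by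
  obtain ⟨d, hd, hx⟩ := h.exists_inShadow_add
  have hyx := hy _ hx
  have hnorm := hx.2
  simp only [inner_add_left, inner_add_right, real_inner_smul_left, real_inner_smul_right,
    real_inner_comm d c] at hyx hnorm
  have hdc := h.inner_mem hd h.char_mem
  rcases h.mem_or_of_inDerived hy with ha | ha
  · convert add_mem (sub_mem hyx (h.inner_mem' ha hd)) (h.char y ha) using 1
    rw [real_inner_comm y c]; ring
  · have h1 := h.inner_mem' ha hd
    have h2 := h.char _ ha
    have h3 := h.inner_mem' ha h.char_mem'
    simp only [inner_sub_left, inner_sub_right] at h1 h2 h3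
    have h4 := add_mem (sub_mem hyx h1) (h.char' d hd)
    have h5 := add_mem (sub_mem h4 hnorm) hdc
    convert add_mem (add_mem (add_mem h5 h3) h2) h.key using 1
    rw [real_inner_comm y c, real_inner_comm c' c, real_inner_comm y c']
    ring

/-- The twice derived lattice consists of the vectors of even norm in the dual of
`{d ∈ D : d · d ∈ ℤ_(2)}`. -/
theorem inDerived_iff {y : V} : InDerived A y ↔ InDualShadow D y := by
  refine ⟨fun hy => ⟨fun _ hd hdd => hy _ (h.inShadow_of_mem hd hdd), h.norm_even_of_inDerived hy⟩,
    fun ⟨hy, hyy⟩ x hx => ?_⟩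
  have hnorm := hx.2
  rcases h.mem_or_of_inner_mem hy with ha | ha <;> rcases h.mem_or_of_inEvenDual hx.1 with hd | hd
  · exact h.inner_mem' ha hd
  · have h1 := h.inner_mem' ha hd
    have h2 := h.char _ ha
    simp only [inner_sub_right, real_inner_smul_right] at h1 h2
    convert sub_mem (add_mem h1 hyy) h2 using 1
    rw [real_inner_comm y c]; ring
  · have h1 := h.inner_mem' ha hd
    rw [inner_sub_left] at h1
    convert sub_mem (add_mem h1 hnorm) (h.char' x hd) using 1
    ring
  · have h1 := h.inner_mem' ha hd
    have h2 := h.char _ ha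
    have h3 := h.inner_mem' ha h.char_mem'
    have h4 := h.char' _ hd
    have h5 := h.inner_mem hd h.char_mem
    simp only [inner_sub_left, inner_sub_right, real_inner_smul_left, real_inner_smul_right]
      at h1 h2 h3 h4 h5
    have h6 := sub_mem (sub_mem (sub_mem (add_mem h1 hyy) h2) h4) h3
    convert sub_mem (sub_mem (add_mem h6 hnorm) h5) h.key using 1
    rw [real_inner_comm y c, real_inner_comm c' c, real_inner_comm y c', real_inner_comm x c,
      real_inner_comm x c']
    ring

end LocalSetup

end Local

/-! ### Similarities at the prime 2 -/

theorem inv_mem_twoIntegers {x : ℝ} (hx : x ∈ twoIntegers) (h : x / 2 ∉ twoIntegers) :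
    x⁻¹ ∈ twoIntegers := by
  obtain ⟨k, hk, m, hm⟩ := isPInt_iff_exists_nat_mul.1 hx
  have hm2 : ¬ 2 ∣ m.natAbs := by
    rw [← Int.natCast_dvd]
    rintro ⟨l, rfl⟩
    refine h (isPInt_iff_exists_nat_mul.2 ⟨k, hk, l, ?_⟩)
    push_cast at hm
    linear_combination hm / 2
  refine isPInt_iff_exists_nat_mul.2 ⟨m.natAbs, hm2, m.sign * k, ?_⟩
  have hx0 : x ≠ 0 := by
    rintro rfl
    exact h (by simp)
  have h1 : (m.natAbs : ℝ) = m.sign * m := by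
    have := congrArg (Int.cast : ℤ → ℝ) (Int.sign_mul_self_eq_abs m)
    rw [Int.abs_eq_natAbs, Int.cast_natCast, Int.cast_mul] at this
    exact this.symm
  rw [h1, ← hm]
  push_cast
  field_simp

section Local

variable {V : Type*} [NormedAddCommGroup V] [InnerProductSpace ℝ V]

local notation "⟪" x ", " y "⟫" => inner ℝ x y

theorem inner_map_map_of_norm {N : ℝ} {σ : V →ₗ[ℝ] V} (hσ : ∀ x, ⟪σ x, σ x⟫ = N * ⟪x, x⟫)
    (x y : V) : ⟪σ x, σ y⟫ = N * ⟪x, y⟫ := by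
  have h := hσ (x + y)
  rw [map_add, real_inner_add_add_self, real_inner_add_add_self, hσ, hσ] at h
  linarith

variable {A D : Submodule ℤ V} {N : ℝ} {σ τ : V →ₗ[ℝ] V}

/-- A similarity preserving an odd lattice multiplies norms by a 2-adic unit. -/
theorem mem_and_inv_mem_of_map_eq (hA : ∀ u ∈ A, ⟪u, u⟫ ∈ twoIntegers)
    (hodd : ∃ u ∈ A, ⟪u, u⟫ / 2 ∉ twoIntegers) (hσ : ∀ x, ⟪σ x, σ x⟫ = N * ⟪x, x⟫)
    (hN : N ≠ 0) (hmap : ∀ x, x ∈ A ↔ σ x ∈ A) (hsurj : Function.Surjective σ) :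
    N ∈ twoIntegers ∧ N⁻¹ ∈ twoIntegers := by
  obtain ⟨v, hv, hvn⟩ := hodd
  have hinv := inv_mem_twoIntegers (hA v hv) hvn
  have hv0 : ⟪v, v⟫ ≠ 0 := by
    intro h
    rw [h] at hvn
    exact hvn (by simp)
  constructor
  · convert mul_mem (hA _ ((hmap v).1 hv)) hinv using 1
    rw [hσ]; field_simp
  · obtain ⟨w, rfl⟩ := hsurj v
    convert mul_mem (hA _ ((hmap w).2 hv)) hinv using 1
    rw [hσ] at hv0 ⊢
    have : ⟪w, w⟫ ≠ 0 := right_ne_zero_of_mul hv0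
    field_simp

/-- If one similarity from the dual `D` onto an odd lattice `A` doubles norms, then every other
one doubles them up to a 2-adic unit. -/
theorem half_mem_and_two_div_mem_of_map_eq (hA : ∀ u ∈ A, ⟪u, u⟫ ∈ twoIntegers)
    (hodd : ∃ u ∈ A, ⟪u, u⟫ / 2 ∉ twoIntegers) (hτ : ∀ x, ⟪τ x, τ x⟫ = 2 * ⟪x, x⟫)
    (hτmap : ∀ x, x ∈ D ↔ τ x ∈ A) (hτsurj : Function.Surjective τ)
    (hσ : ∀ x, ⟪σ x, σ x⟫ = N * ⟪x, x⟫) (hN : N ≠ 0)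
    (hmap : ∀ x, x ∈ D ↔ σ x ∈ A) (hsurj : Function.Surjective σ) :
    N / 2 ∈ twoIntegers ∧ 2 / N ∈ twoIntegers := by
  obtain ⟨v, hv, hvn⟩ := hodd
  have hinv := inv_mem_twoIntegers (hA v hv) hvn
  have hv0 : ⟪v, v⟫ ≠ 0 := by
    intro h
    rw [h] at hvn
    exact hvn (by simp)
  constructor
  · obtain ⟨w, rfl⟩ := hτsurj v
    convert mul_mem (hA _ ((hmap w).1 ((hτmap w).2 hv))) hinv using 1
    rw [hτ] at hv0 ⊢
    rw [hσ]
    have : ⟪w, w⟫ ≠ 0 := right_ne_zero_of_mul hv0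
    field_simp
  · obtain ⟨w, rfl⟩ := hsurj v
    convert mul_mem (hA _ ((hτmap w).1 ((hmap w).2 hv))) hinv using 1
    rw [hσ] at hv0 ⊢
    rw [hτ]
    have : ⟪w, w⟫ ≠ 0 := right_ne_zero_of_mul hv0
    field_simp

theorem inEvenDual_map_iff (hσ : ∀ x, ⟪σ x, σ x⟫ = N * ⟪x, x⟫) (hN : N ≠ 0)
    (h1 : N ∈ twoIntegers) (h2 : N⁻¹ ∈ twoIntegers)
    (hmap : ∀ x, x ∈ A ↔ σ x ∈ A) (hsurj : Function.Surjective σ) (x : V) :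
    InEvenDual A x ↔ InEvenDual A (σ x) := by
  constructor
  · intro hx u hu hev
    obtain ⟨u, rfl⟩ := hsurj u
    rw [inner_map_map_of_norm hσ]
    refine mul_mem h1 (hx u ((hmap u).2 hu) ?_)
    convert mul_mem h2 hev using 1
    rw [hσ]; field_simp
  · intro hx u hu hev
    convert mul_mem h2 (hx (σ u) ((hmap u).1 hu) ?_) using 1
    · rw [inner_map_map_of_norm hσ]; field_simp
    · convert mul_mem h1 hev using 1
      rw [hσ]; ring

/-- A similarity preserving `A` preserves the twice derived lattice. -/
theorem inDerived_map_iff (hσ : ∀ x, ⟪σ x, σ x⟫ = N * ⟪x, x⟫) (hN : N ≠ 0)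
    (h1 : N ∈ twoIntegers) (h2 : N⁻¹ ∈ twoIntegers)
    (hmap : ∀ x, x ∈ A ↔ σ x ∈ A) (hsurj : Function.Surjective σ) (y : V) :
    InDerived A y ↔ InDerived A (σ y) := by
  have hsh : ∀ x, InShadow A x ↔ InShadow A (σ x) := by
    intro x
    refine and_congr (inEvenDual_map_iff hσ hN h1 h2 hmap hsurj x)
      ⟨fun h => ?_, fun h => ?_⟩
    · rw [hσ]; exact mul_mem h1 h
    · convert mul_mem h2 h using 1
      rw [hσ]; field_simp
  constructor
  · intro hy x hx
    obtain ⟨x, rfl⟩ := hsurj x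
    rw [inner_map_map_of_norm hσ]
    exact mul_mem h1 (hy x ((hsh x).2 hx))
  · intro hy x hx
    convert mul_mem h2 (hy (σ x) ((hsh x).1 hx)) using 1
    rw [inner_map_map_of_norm hσ]; field_simp

/-- A similarity mapping `D` onto `A` maps the dual of the twice derived lattice onto the twice
derived lattice. -/
theorem LocalSetup.inShadow_iff_inDerived_map {c c' : V} (h : LocalSetup A D c c')
    (hσ : ∀ x, ⟪σ x, σ x⟫ = N * ⟪x, x⟫) (hN : N ≠ 0)
    (h1 : N / 2 ∈ twoIntegers) (h2 : 2 / N ∈ twoIntegers)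
    (hmap : ∀ x, x ∈ D ↔ σ x ∈ A) (hsurj : Function.Surjective σ) (x : V) :
    InShadow A x ↔ InDerived A (σ x) := by
  have hAD : ∀ u, u ∈ A ↔ (1 / 2 : ℝ) • σ u ∈ D := by
    intro u
    constructor
    · intro hu
      rw [h.mem_dual]
      intro y hy
      obtain ⟨z, rfl⟩ := hsurj y
      convert mul_mem h1 (h.inner_mem' hu ((hmap z).2 hy)) using 1
      rw [real_inner_smul_left, inner_map_map_of_norm hσ]; ring
    · intro hu
      rw [h.mem_iff]
      intro d hd
      convert mul_mem h2 (h.inner_mem hu ((hmap d).1 hd)) using 1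
      rw [real_inner_smul_left, inner_map_map_of_norm hσ]; field_simp
  rw [h.inDerived_iff]
  refine and_congr ⟨fun hx d hd hdd => ?_, fun hx u hu hev => ?_⟩ ⟨fun hx => ?_, fun hx => ?_⟩
  · obtain ⟨w, rfl⟩ := hsurj d
    have h4 : (1 / 2 : ℝ) • σ ((2 : ℝ) • w) = σ w := by
      rw [map_smul, smul_smul]; norm_num
    convert mul_mem h1 (hx ((2 : ℝ) • w) ((hAD _).2 (by rwa [h4])) ?_) using 1
    · rw [inner_map_map_of_norm hσ, real_inner_smul_right]; ring
    · convert mul_mem h2 hdd using 1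
      rw [hσ, real_inner_smul_right, real_inner_smul_left]; field_simp
  · convert mul_mem h2 (hx ((1 / 2 : ℝ) • σ u) ((hAD u).1 hu) ?_) using 1
    · rw [real_inner_smul_right, inner_map_map_of_norm hσ]; field_simp
    · convert mul_mem h1 hev using 1
      rw [real_inner_smul_right, real_inner_smul_left, hσ]; ring
  · convert mul_mem h1 hx using 1
    rw [hσ]; ring
  · convert mul_mem h2 hx using 1
    rw [hσ]; field_simp

end Local

/-! ### Lattices, their duals and their localizations -/

section Lattice

variable {n : ℕ} {L M : Submodule ℤ (EuclideanSpace ℝ (Fin n))} {p : ℕ}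

theorem inner_nsmul_left' (k : ℕ) (x y : EuclideanSpace ℝ (Fin n)) :
    inner ℝ (k • x) y = k * inner ℝ x y := by
  rw [← Nat.cast_smul_eq_nsmul ℝ, real_inner_smul_left]

theorem isLattice_iff_exists_basis : IsLattice L ↔
    ∃ b : Module.Basis (Fin n) ℝ (EuclideanSpace ℝ (Fin n)),
      Submodule.span ℤ (Set.range b) = L := by
  constructor
  · rintro ⟨h1, h2⟩
    have : Module.Finite ℤ L := ZLattice.module_finite ℝ L
    have : Module.Free ℤ L := ZLattice.module_free ℝ L
    have hr : Module.finrank ℤ L = n := by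
      rw [ZLattice.rank ℝ L, finrank_euclideanSpace_fin]
    let b : Module.Basis (Fin n) ℤ L := Module.finBasisOfFinrankEq ℤ L hr
    exact ⟨b.ofZLatticeBasis ℝ L, b.ofZLatticeBasis_span ℝ⟩
  · rintro ⟨b, rfl⟩
    exact ⟨inferInstance, inferInstance⟩

/-- A lattice with rational inner products. -/
structure IsRational (L : Submodule ℤ (EuclideanSpace ℝ (Fin n))) : Prop where
  isLattice : IsLattice L
  rational : ∀ u ∈ L, ∀ v ∈ L, ∃ q : ℚ, inner ℝ u v = q

theorem IsIntegral.isRational (h : IsIntegral L) : IsRational L :=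
  ⟨h.isLattice, fun u hu v hv => by
    obtain ⟨k, hk⟩ := h.integral u hu v hv
    exact ⟨k, by rw [hk]; simp⟩⟩

theorem mem_dual_iff {x : EuclideanSpace ℝ (Fin n)} :
    x ∈ dual L ↔ ∀ u ∈ L, ∃ k : ℤ, inner ℝ x u = k := by
  rw [dual, LinearMap.BilinForm.mem_dualSubmodule]
  refine forall₂_congr fun u _ => ?_
  rw [Submodule.mem_one]
  exact exists_congr fun k => by simp [eq_comm]

theorem innerBilin_nondegenerate :
    (innerₗ (EuclideanSpace ℝ (Fin n)) : LinearMap.BilinForm ℝ _).Nondegenerate := by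
  refine ⟨fun x hx => ?_, fun x hx => ?_⟩ <;> exact inner_self_eq_zero.1 (hx x)

theorem IsLattice.dual (h : IsLattice L) : IsLattice (dual L) := by
  obtain ⟨b, rfl⟩ := isLattice_iff_exists_basis.1 h
  refine isLattice_iff_exists_basis.2 ⟨_, (LinearMap.BilinForm.dualSubmodule_span_of_basis
    (innerₗ (EuclideanSpace ℝ (Fin n))) innerBilin_nondegenerate b).symm⟩

theorem IsLattice.dual_dual (h : IsLattice L) :
    ModularLattice.dual (ModularLattice.dual L) = L := by
  obtain ⟨b, rfl⟩ := isLattice_iff_exists_basis.1 h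
  refine LinearMap.BilinForm.dualSubmodule_dualSubmodule_of_basis _ innerBilin_nondegenerate ?_ b
  exact ⟨fun x y => real_inner_comm y x⟩

theorem rational_of_mem_ratSpan (h : IsRational L) {x y : EuclideanSpace ℝ (Fin n)}
    (hx : x ∈ ratSpan L) (hy : y ∈ ratSpan L) : ∃ q : ℚ, inner ℝ x y = q := by
  have hsm : ∀ (a : ℚ) (z : EuclideanSpace ℝ (Fin n)), a • z = (a : ℝ) • z := fun a z =>
    (Rat.cast_smul_eq_qsmul ℝ a z).symm
  induction hx using Submodule.span_induction with
  | mem u hu =>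
    induction hy using Submodule.span_induction with
    | mem v hv => exact h.rational u hu v hv
    | zero => exact ⟨0, by simp⟩
    | add v w _ _ hv hw =>
      obtain ⟨a, ha⟩ := hv
      obtain ⟨b, hb⟩ := hw
      exact ⟨a + b, by rw [inner_add_right, ha, hb]; push_cast; rfl⟩
    | smul a v _ hv =>
      obtain ⟨b, hb⟩ := hv
      exact ⟨a * b, by rw [hsm, real_inner_smul_right, hb]; push_cast; rfl⟩
  | zero => exact ⟨0, by simp⟩
  | add v w _ _ hv hw =>
    obtain ⟨a, ha⟩ := hv
    obtain ⟨b, hb⟩ := hw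
    exact ⟨a + b, by rw [inner_add_left, ha, hb]; push_cast; rfl⟩
  | smul a v _ hv =>
    obtain ⟨b, hb⟩ := hv
    exact ⟨a * b, by rw [hsm, real_inner_smul_left, hb]; push_cast; rfl⟩

theorem exists_nsmul_mem_of_mem_ratSpan {x : EuclideanSpace ℝ (Fin n)} (hx : x ∈ ratSpan L) :
    ∃ k : ℕ, k ≠ 0 ∧ k • x ∈ L := by
  induction hx using Submodule.span_induction with
  | mem u hu => exact ⟨1, one_ne_zero, by simpa using hu⟩
  | zero => exact ⟨1, one_ne_zero, by simp⟩
  | add v w _ _ hv hw =>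
    obtain ⟨k, hk, hv⟩ := hv
    obtain ⟨l, hl, hw⟩ := hw
    refine ⟨k * l, mul_ne_zero hk hl, ?_⟩
    rw [smul_add, mul_comm k l, mul_smul, mul_comm l k, mul_smul]
    exact add_mem (nsmul_mem hv l) (nsmul_mem hw k)
  | smul a v _ hv =>
    obtain ⟨k, hk, hv⟩ := hv
    refine ⟨k * a.den, mul_ne_zero hk a.den_ne_zero, ?_⟩
    have : (k * a.den) • a • v = a.num • k • v := by
      rw [← Nat.cast_smul_eq_nsmul ℚ, ← Int.cast_smul_eq_zsmul ℚ, ← Nat.cast_smul_eq_nsmul ℚ,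
        smul_smul, smul_smul]
      congr 1
      push_cast
      rw [mul_assoc, Rat.den_mul_eq_num, mul_comm]
    rw [this]
    exact L.smul_mem _ hv

theorem mem_ratSpan_of_nsmul_mem {x : EuclideanSpace ℝ (Fin n)} {k : ℕ} (hk : k ≠ 0)
    (hx : k • x ∈ ratSpan L) : x ∈ ratSpan L := by
  have : x = (k : ℚ)⁻¹ • k • x := by
    rw [← Nat.cast_smul_eq_nsmul ℚ, smul_smul, inv_mul_cancel₀ (Nat.cast_ne_zero.2 hk), one_smul]
  rw [this]
  exact Submodule.smul_mem _ _ hx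

theorem subset_ratSpan : (L : Set (EuclideanSpace ℝ (Fin n))) ⊆ ratSpan L := Submodule.subset_span

/-- The Gram matrix of a basis is invertible over `ℚ`. -/
theorem isUnit_det_of_eq_inner {ι : Type*} [Fintype ι] [DecidableEq ι]
    (b : Module.Basis ι ℝ (EuclideanSpace ℝ (Fin n)))
    (G : Matrix ι ι ℚ) (hG : ∀ i j, inner ℝ (b i) (b j) = G i j) : G.det ≠ 0 := by
  intro h0
  obtain ⟨v, hv, hv0⟩ := Matrix.exists_vecMul_eq_zero_iff.2 h0
  have h1 : ∑ i, (v i : ℝ) • b i = 0 := by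
    apply InnerProductSpace.ext_inner_right_basis b
    intro j
    rw [sum_inner, inner_zero_left]
    have := congrFun hv0 j
    simp only [Matrix.vecMul, dotProduct, Pi.zero_apply] at this
    simp_rw [real_inner_smul_left, hG]
    exact_mod_cast this
  have h2 := Fintype.linearIndependent_iff.1 b.linearIndependent _ h1
  exact hv (funext fun i => by exact_mod_cast h2 i)

/-- A vector whose inner products with a rational lattice are rational lies in its rational span. -/
theorem mem_ratSpan_of_forall_inner (h : IsRational L) {x : EuclideanSpace ℝ (Fin n)}
    (hx : ∀ u ∈ L, ∃ q : ℚ, inner ℝ x u = q) : x ∈ ratSpan L := by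
  obtain ⟨b, rfl⟩ := isLattice_iff_exists_basis.1 h.isLattice
  have hb : ∀ i, b i ∈ Submodule.span ℤ (Set.range b) := fun i => Submodule.subset_span ⟨i, rfl⟩
  choose G hG using fun i j => h.rational _ (hb i) _ (hb j)
  have hdet := isUnit_det_of_eq_inner b (Matrix.of G) hG
  choose q hq using fun i => hx _ (hb i)
  let a := Matrix.vecMul q (Matrix.of G)⁻¹
  have ha : Matrix.vecMul a (Matrix.of G) = q := by
    rw [Matrix.vecMul_vecMul, Matrix.nonsing_inv_mul _ (isUnit_iff_ne_zero.2 hdet),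
      Matrix.vecMul_one]
  have : x = ∑ i, a i • b i := by
    apply InnerProductSpace.ext_inner_right_basis b
    intro j
    rw [sum_inner, hq]
    simp_rw [← Rat.cast_smul_eq_qsmul ℝ, real_inner_smul_left, hG]
    have := congrFun ha j
    simp only [Matrix.vecMul, dotProduct, Matrix.of_apply] at this
    exact_mod_cast this.symm
  rw [this]
  exact Submodule.sum_mem _ fun i _ => Submodule.smul_mem _ _ (subset_ratSpan (hb i))

theorem dual_le_ratSpan (h : IsRational L) {x : EuclideanSpace ℝ (Fin n)} (hx : x ∈ dual L) :
    x ∈ ratSpan L :=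
  mem_ratSpan_of_forall_inner h fun u hu => by
    obtain ⟨k, hk⟩ := mem_dual_iff.1 hx u hu
    exact ⟨k, by rw [hk]; simp⟩

theorem IsRational.dual (h : IsRational L) : IsRational (dual L) :=
  ⟨h.isLattice.dual, fun _ hu _ hv =>
    rational_of_mem_ratSpan h (dual_le_ratSpan h hu) (dual_le_ratSpan h hv)⟩

/-- A lattice in the rational span of `L` has a multiple contained in `L`. -/
theorem exists_nsmul_mem_of_le_ratSpan (hM : IsLattice M)
    (h : ∀ x ∈ M, x ∈ ratSpan L) : ∃ k : ℕ, k ≠ 0 ∧ ∀ x ∈ M, k • x ∈ L := by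
  obtain ⟨b, rfl⟩ := isLattice_iff_exists_basis.1 hM
  choose k hk hkb using fun i =>
    exists_nsmul_mem_of_mem_ratSpan (h _ (Submodule.subset_span ⟨i, rfl⟩))
  refine ⟨∏ i, k i, Finset.prod_ne_zero_iff.2 fun i _ => hk i, fun x hx => ?_⟩
  induction hx using Submodule.span_induction with
  | mem u hu =>
    obtain ⟨i, rfl⟩ := hu
    rw [← Finset.prod_erase_mul _ _ (Finset.mem_univ i), mul_smul]
    exact nsmul_mem (hkb i) _
  | zero => simp
  | add v w _ _ hv hw => rw [smul_add]; exact add_mem hv hw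
  | smul a v _ hv => rw [smul_comm]; exact L.smul_mem _ hv

theorem IsRational.exists_nsmul_dual (h : IsRational L) :
    ∃ k : ℕ, k ≠ 0 ∧ (∀ x ∈ ModularLattice.dual L, k • x ∈ L) ∧
      ∀ x ∈ L, k • x ∈ ModularLattice.dual L := by
  obtain ⟨k, hk, h1⟩ := exists_nsmul_mem_of_le_ratSpan h.isLattice.dual
    (fun x hx => dual_le_ratSpan h hx)
  obtain ⟨l, hl, h2⟩ := exists_nsmul_mem_of_le_ratSpan (L := ModularLattice.dual L) h.isLattice
    (fun x hx => dual_le_ratSpan h.dual (by rwa [h.isLattice.dual_dual]))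
  refine ⟨k * l, mul_ne_zero hk hl, fun x hx => ?_, fun x hx => ?_⟩
  · rw [mul_comm, mul_smul]; exact nsmul_mem (h1 x hx) l
  · rw [mul_smul]; exact nsmul_mem (h2 x hx) k

theorem mem_scale_iff {c : ℝ} (hc : c ≠ 0) {x : EuclideanSpace ℝ (Fin n)} :
    x ∈ scale c L ↔ c⁻¹ • x ∈ L := by
  rw [scale, Submodule.mem_map]
  constructor
  · rintro ⟨y, hy, rfl⟩
    simpa [smul_smul, hc] using hy
  · intro h
    exact ⟨_, h, by simp [smul_smul, hc]⟩

theorem smul_mem_scale (c : ℝ) {x : EuclideanSpace ℝ (Fin n)} (hx : x ∈ L) : c • x ∈ scale c L :=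
  Submodule.mem_map_of_mem hx

theorem IsLattice.scale (h : IsLattice L) {c : ℝ} (hc : c ≠ 0) : IsLattice (scale c L) := by
  obtain ⟨b, rfl⟩ := isLattice_iff_exists_basis.1 h
  refine isLattice_iff_exists_basis.2 ⟨b.unitsSMul fun _ => Units.mk0 c hc, ?_⟩
  rw [ModularLattice.scale, Submodule.map_span, ← Set.range_comp]
  congr 2
  ext1 i
  simp [Module.Basis.unitsSMul_apply, Units.smul_def]

/-- A subgroup commensurable with a lattice is a lattice. -/
theorem IsLattice.of_commensurable (h : IsLattice L) {k : ℕ} (hk : k ≠ 0)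
    (h1 : ∀ x ∈ L, k • x ∈ M) (h2 : ∀ x ∈ M, k • x ∈ L) : IsLattice M := by
  have hk0 : (k : ℝ) ≠ 0 := Nat.cast_ne_zero.2 hk
  obtain ⟨hd, hs⟩ := h.scale (inv_ne_zero hk0)
  have hle : M ≤ ModularLattice.scale (k : ℝ)⁻¹ L := fun x hx => by
    rw [mem_scale_iff (inv_ne_zero hk0), inv_inv, Nat.cast_smul_eq_nsmul]
    exact h2 x hx
  have hdM : DiscreteTopology M :=
    DiscreteTopology.of_continuous_injective (f := Submodule.inclusion hle)
      (Continuous.subtype_mk continuous_subtype_val _) (Submodule.inclusion_injective hle)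
  refine ⟨hdM, ⟨?_⟩⟩
  obtain ⟨b, rfl⟩ := isLattice_iff_exists_basis.1 h
  rw [eq_top_iff, ← b.span_eq, Submodule.span_le]
  rintro _ ⟨i, rfl⟩
  have : b i = (k : ℝ)⁻¹ • k • b i := by
    rw [← Nat.cast_smul_eq_nsmul ℝ, smul_smul, inv_mul_cancel₀ hk0, one_smul]
  rw [SetLike.mem_coe, this]
  exact Submodule.smul_mem _ _ (Submodule.subset_span (h1 _ (Submodule.subset_span ⟨i, rfl⟩)))

theorem ratSpan_eq_of_commensurable {k : ℕ} (hk : k ≠ 0)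
    (h1 : ∀ x ∈ L, k • x ∈ M) (h2 : ∀ x ∈ M, k • x ∈ L) : ratSpan M = ratSpan L := by
  apply le_antisymm
  · exact Submodule.span_le.2 fun x hx => mem_ratSpan_of_nsmul_mem hk (subset_ratSpan (h2 x hx))
  · exact Submodule.span_le.2 fun x hx => mem_ratSpan_of_nsmul_mem hk (subset_ratSpan (h1 x hx))

theorem IsRational.of_commensurable (h : IsRational L) {k : ℕ} (hk : k ≠ 0)
    (h1 : ∀ x ∈ L, k • x ∈ M) (h2 : ∀ x ∈ M, k • x ∈ L) : IsRational M := by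
  refine ⟨h.isLattice.of_commensurable hk h1 h2, fun u hu v hv => ?_⟩
  rw [← SetLike.mem_coe] at hu hv
  have hu := subset_ratSpan hu
  have hv := subset_ratSpan hv
  rw [SetLike.mem_coe, ratSpan_eq_of_commensurable hk h1 h2] at hu hv
  exact rational_of_mem_ratSpan h hu hv

/-! ### Localization at a prime -/

/-- The localization `L ⊗ ℤ_(p)` of `L`, as a subset of the ambient space: the vectors that have a
multiple by an integer prime to `p` in `L`. -/
def loc (p : ℕ) (hp : p.Prime) (L : Submodule ℤ (EuclideanSpace ℝ (Fin n))) :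
    Submodule ℤ (EuclideanSpace ℝ (Fin n)) where
  carrier := {x | ∃ k : ℕ, ¬ p ∣ k ∧ k • x ∈ L}
  zero_mem' := ⟨1, by simpa using hp.ne_one, by simp⟩
  add_mem' := by
    rintro x y ⟨k, hk, hx⟩ ⟨l, hl, hy⟩
    refine ⟨k * l, fun hd => ((hp.dvd_mul).1 hd).elim hk hl, ?_⟩
    rw [smul_add, mul_comm k l, mul_smul, mul_comm l k, mul_smul]
    exact add_mem (nsmul_mem hx l) (nsmul_mem hy k)
  smul_mem' := by
    rintro a x ⟨k, hk, hx⟩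
    exact ⟨k, hk, by rw [smul_comm]; exact L.smul_mem _ hx⟩

variable {hp : p.Prime} {x : EuclideanSpace ℝ (Fin n)}

theorem mem_loc_iff : x ∈ loc p hp L ↔ ∃ k : ℕ, ¬ p ∣ k ∧ k • x ∈ L := Iff.rfl

theorem le_loc : L ≤ loc p hp L := fun x hx => ⟨1, by simpa using hp.ne_one, by simpa using hx⟩

theorem loc_mono (h : L ≤ M) : loc p hp L ≤ loc p hp M := fun _ ⟨k, hk, hx⟩ => ⟨k, hk, h hx⟩

theorem mem_loc_of_nsmul {k : ℕ} (hk : ¬ p ∣ k) (hx : k • x ∈ loc p hp L) : x ∈ loc p hp L := by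
  obtain ⟨l, hl, h⟩ := hx
  exact ⟨l * k, fun hd => ((hp.dvd_mul).1 hd).elim hl hk, by rwa [mul_smul]⟩

theorem mem_ratSpan_of_mem_loc (hx : x ∈ loc p hp L) : x ∈ ratSpan L := by
  obtain ⟨k, hk, h⟩ := hx
  exact mem_ratSpan_of_nsmul_mem (by rintro rfl; exact hk (dvd_zero p)) (subset_ratSpan h)

theorem mem_loc_dual_iff (h : IsLattice L) :
    x ∈ loc p hp (dual L) ↔ ∀ u ∈ L, IsPInt p (inner ℝ x u) := by
  constructor
  · rintro ⟨k, hk, hx⟩ u hu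
    obtain ⟨m, hm⟩ := mem_dual_iff.1 hx u hu
    exact isPInt_iff_exists_nat_mul.2 ⟨k, hk, m, by rw [← hm, inner_nsmul_left']⟩
  · intro hx
    obtain ⟨b, rfl⟩ := isLattice_iff_exists_basis.1 h
    choose k hk m hm using fun i =>
      isPInt_iff_exists_nat_mul.1 (hx _ (Submodule.subset_span ⟨i, rfl⟩))
    refine ⟨∏ i, k i, fun hd => ?_, ?_⟩
    · obtain ⟨i, -, hi⟩ := (Prime.dvd_finsetProd_iff hp.prime _).1 hd
      exact hk i hi
    · rw [mem_dual_iff]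
      intro u hu
      induction hu using Submodule.span_induction with
      | mem u hu =>
        obtain ⟨i, rfl⟩ := hu
        refine ⟨(∏ j ∈ Finset.univ.erase i, k j : ℕ) * m i, ?_⟩
        rw [← Finset.prod_erase_mul _ _ (Finset.mem_univ i), inner_nsmul_left', Nat.cast_mul,
          mul_assoc, hm]
        simp
      | zero => exact ⟨0, by simp⟩
      | add v w _ _ hv hw =>
        obtain ⟨a, ha⟩ := hv
        obtain ⟨b, hb⟩ := hw
        exact ⟨a + b, by rw [inner_add_right, ha, hb]; push_cast; rfl⟩
      | smul a v _ hv =>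
        obtain ⟨b, hb⟩ := hv
        exact ⟨a * b, by
          rw [← Int.cast_smul_eq_zsmul ℝ, real_inner_smul_right, hb]; push_cast; rfl⟩

theorem mem_loc_dual_iff_loc (h : IsLattice L) :
    x ∈ loc p hp (dual L) ↔ ∀ u ∈ loc p hp L, IsPInt p (inner ℝ x u) := by
  rw [mem_loc_dual_iff h]
  refine ⟨fun hx u ⟨k, hk, hu⟩ => ?_, fun hx u hu => hx u (le_loc hu)⟩
  refine IsPInt.of_nat_mul hp hk ?_
  rw [real_inner_comm, ← inner_nsmul_left', real_inner_comm]
  exact hx _ hu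

theorem mem_loc_iff_dual (h : IsLattice L) :
    x ∈ loc p hp L ↔ ∀ u ∈ dual L, IsPInt p (inner ℝ x u) := by
  rw [← mem_loc_dual_iff h.dual, h.dual_dual]

theorem mem_loc_iff_loc_dual (h : IsLattice L) :
    x ∈ loc p hp L ↔ ∀ u ∈ loc p hp (dual L), IsPInt p (inner ℝ x u) := by
  rw [← mem_loc_dual_iff_loc h.dual, h.dual_dual]

/-- Localizations of duals are determined by localizations. -/
theorem loc_dual_congr (hL : IsLattice L) (hM : IsLattice M) (h : loc p hp L = loc p hp M) :
    loc p hp (dual L) = loc p hp (dual M) := by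
  ext x
  rw [mem_loc_dual_iff_loc hL, mem_loc_dual_iff_loc hM, h]

/-- A lattice is the intersection of its localizations. -/
theorem mem_of_forall_mem_loc (h : IsLattice L) (hx : ∀ p (hp : p.Prime), x ∈ loc p hp L) :
    x ∈ L := by
  rw [← h.dual_dual, mem_dual_iff]
  exact fun u hu => exists_int_eq_of_forall_isPInt fun p hp => (mem_loc_iff_dual h).1 (hx p hp) u hu

theorem mem_piDual_iff (h : IsRational L) {S : Set Nat.Primes} :
    x ∈ piDual S L ↔ (∀ p : Nat.Primes, p ∈ S → x ∈ loc p p.2 (dual L)) ∧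
      ∀ p : Nat.Primes, p ∉ S → x ∈ loc p p.2 L := by
  change (x ∈ ratSpan L ∧ _ ∧ _) ↔ _
  simp_rw [mem_loc_dual_iff h.isLattice, mem_loc_iff_dual h.isLattice]
  refine and_iff_right_of_imp fun ⟨h1, h2⟩ => ?_
  by_cases h0 : (⟨2, Nat.prime_two⟩ : Nat.Primes) ∈ S
  · have h3 := (mem_loc_dual_iff (hp := Nat.prime_two) h.isLattice).2 (h1 _ h0)
    obtain ⟨k, hk, h4⟩ := h3
    exact mem_ratSpan_of_nsmul_mem (by rintro rfl; exact hk (dvd_zero _)) (dual_le_ratSpan h h4)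
  · exact mem_ratSpan_of_mem_loc ((mem_loc_iff_dual (hp := Nat.prime_two) h.isLattice).2 (h2 _ h0))

/-- The `S`-dual is commensurable with `L`. -/
theorem exists_nsmul_piDual (h : IsRational L) (S : Set Nat.Primes) :
    ∃ k : ℕ, k ≠ 0 ∧ (∀ x ∈ L, k • x ∈ piDual S L) ∧ ∀ x ∈ piDual S L, k • x ∈ L := by
  obtain ⟨k, hk, h1, h2⟩ := h.exists_nsmul_dual
  refine ⟨k, hk, fun x hx => ?_, fun x hx => ?_⟩
  · exact (mem_piDual_iff h).2 ⟨fun p _ => le_loc (h2 x hx), fun p _ => le_loc (nsmul_mem hx k)⟩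
  · obtain ⟨h3, h4⟩ := (mem_piDual_iff h).1 hx
    refine mem_of_forall_mem_loc h.isLattice fun p hp => ?_
    by_cases hS : (⟨p, hp⟩ : Nat.Primes) ∈ S
    · obtain ⟨l, hl, h5⟩ := h3 _ hS
      exact ⟨l, hl, by rw [smul_comm]; exact h1 _ h5⟩
    · exact nsmul_mem (h4 _ hS) k

theorem IsRational.piDual (h : IsRational L) (S : Set Nat.Primes) : IsRational (piDual S L) := by
  obtain ⟨k, hk, h1, h2⟩ := exists_nsmul_piDual h S
  exact h.of_commensurable hk h1 h2

theorem ratSpan_piDual (h : IsRational L) (S : Set Nat.Primes) :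
    ratSpan (piDual S L) = ratSpan L := by
  obtain ⟨k, hk, h1, h2⟩ := exists_nsmul_piDual h S
  exact ratSpan_eq_of_commensurable hk h1 h2

/-- A vector having a prime-to-`p` multiple in the lattice that the `S`-dual prescribes at `p` lies
in the localization of the `S`-dual at `p`. The other primes are handled by commensurability. -/
theorem mem_loc_piDual_of_mem (h : IsRational L) {S : Set Nat.Primes} {k : ℕ} (hk : ¬ p ∣ k)
    (hx1 : (⟨p, hp⟩ : Nat.Primes) ∈ S → k • x ∈ dual L)
    (hx2 : (⟨p, hp⟩ : Nat.Primes) ∉ S → k • x ∈ L) : x ∈ loc p hp (piDual S L) := by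
  obtain ⟨N, hN, h1, h2⟩ := h.exists_nsmul_dual
  obtain ⟨a, u, hu, hNu⟩ := Nat.exists_eq_pow_mul_and_not_dvd hN p hp.ne_one
  -- Away from `p`, membership may be tested after multiplication by a power of `p`.
  have hN2 : (N * N) • k • x ∈ L ∧ (N * N) • k • x ∈ dual L := by
    by_cases hS : (⟨p, hp⟩ : Nat.Primes) ∈ S
    · have h3 := h1 _ (hx1 hS)
      rw [mul_smul]
      exact ⟨nsmul_mem h3 N, h2 _ h3⟩
    · have h3 := h2 _ (hx2 hS)
      rw [mul_smul]
      exact ⟨h1 _ h3, nsmul_mem h3 N⟩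
  have hNN : N * N = p ^ (a + a) * (u * u) := by rw [hNu, pow_add]; ring
  rw [hNN, mul_smul] at hN2
  refine ⟨u * u * k, fun hd => ?_, ?_⟩
  · rcases (hp.dvd_mul).1 hd with hd | hd
    · exact hu (or_self_iff.1 ((hp.dvd_mul).1 hd))
    · exact hk hd
  rw [mul_smul, mem_piDual_iff h]
  have hq : ∀ q : Nat.Primes, q ≠ ⟨p, hp⟩ → ¬ (q : ℕ) ∣ p ^ (a + a) := fun q hqp hd =>
    hqp (Subtype.ext ((Nat.prime_dvd_prime_iff_eq q.2 hp).1 (q.2.dvd_of_dvd_pow hd)))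
  refine ⟨fun q hq1 => ?_, fun q hq1 => ?_⟩
  · by_cases hqp : q = ⟨p, hp⟩
    · subst hqp
      exact le_loc (nsmul_mem (hx1 hq1) _)
    · exact ⟨_, hq q hqp, hN2.2⟩
  · by_cases hqp : q = ⟨p, hp⟩
    · subst hqp
      exact le_loc (nsmul_mem (hx2 hq1) _)
    · exact ⟨_, hq q hqp, hN2.1⟩

theorem loc_piDual_of_mem (h : IsRational L) {S : Set Nat.Primes}
    (hS : (⟨p, hp⟩ : Nat.Primes) ∈ S) : loc p hp (piDual S L) = loc p hp (dual L) := by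
  apply le_antisymm
  · rintro x ⟨k, hk, hx⟩
    exact mem_loc_of_nsmul hk (((mem_piDual_iff h).1 hx).1 _ hS)
  · rintro x ⟨k, hk, hx⟩
    exact mem_loc_piDual_of_mem h hk (fun _ => hx) (fun h' => absurd hS h')

theorem loc_piDual_of_notMem (h : IsRational L) {S : Set Nat.Primes}
    (hS : (⟨p, hp⟩ : Nat.Primes) ∉ S) : loc p hp (piDual S L) = loc p hp L := by
  apply le_antisymm
  · rintro x ⟨k, hk, hx⟩
    exact mem_loc_of_nsmul hk (((mem_piDual_iff h).1 hx).2 _ hS)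
  · rintro x ⟨k, hk, hx⟩
    exact mem_loc_piDual_of_mem h hk (fun h' => absurd h' hS) (fun _ => hx)

end Lattice

/-! ### A basis adapted to a level 2 modularity -/

section Adapted

variable {n : ℕ} {L M : Submodule ℤ (EuclideanSpace ℝ (Fin n))}

theorem injective_of_multipliesNormsBy {N : ℝ} (hN : N ≠ 0)
    {σ : EuclideanSpace ℝ (Fin n) →ₗ[ℝ] EuclideanSpace ℝ (Fin n)} (hσ : MultipliesNormsBy N σ) :
    Function.Injective σ := by
  refine (injective_iff_map_eq_zero σ).2 fun x hx => ?_
  have h := hσ x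
  rw [hx, inner_zero_left, eq_comm, mul_eq_zero, inner_self_eq_zero] at h
  exact h.resolve_left hN

/-- A modularity respects localizations. -/
theorem mem_loc_piDual_iff_map_mem {p : ℕ} {hp : p.Prime} {S : Set Nat.Primes}
    {σ : EuclideanSpace ℝ (Fin n) →ₗ[ℝ] EuclideanSpace ℝ (Fin n)} (hinj : Function.Injective σ)
    (hσ : σ '' (piDual S L : Set (EuclideanSpace ℝ (Fin n))) = L) (x : EuclideanSpace ℝ (Fin n)) :
    x ∈ loc p hp (piDual S L) ↔ σ x ∈ loc p hp L := by
  rw [mem_loc_iff, mem_loc_iff]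
  refine exists_congr fun k => and_congr_right fun _ => ?_
  rw [← map_nsmul, ← SetLike.mem_coe, ← SetLike.mem_coe, ← hσ, hinj.mem_set_image]

/-- Two bases of the same lattice have the same Gram determinant. -/
theorem det_gram_eq_of_span_eq {ι : Type*} [Fintype ι] [DecidableEq ι]
    (b b' : Module.Basis ι ℝ (EuclideanSpace ℝ (Fin n)))
    (h : Submodule.span ℤ (Set.range b) = Submodule.span ℤ (Set.range b')) :
    (Matrix.of fun i j => inner ℝ (b' i) (b' j)).det
      = (Matrix.of fun i j => inner ℝ (b i) (b j)).det := by
  have hint : ∀ b b' : Module.Basis ι ℝ (EuclideanSpace ℝ (Fin n)),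
      Submodule.span ℤ (Set.range b) = Submodule.span ℤ (Set.range b') →
      ∃ U : Matrix ι ι ℤ, (∀ i, b' i = ∑ j, (U i j : ℝ) • b j) := by
    intro b b' h
    have h1 : ∀ i, ∃ u : ι → ℤ, ∑ j, u j • b j = b' i := fun i => by
      have : b' i ∈ Submodule.span ℤ (Set.range b) := h ▸ Submodule.subset_span ⟨i, rfl⟩
      exact (Submodule.mem_span_range_iff_exists_fun ℤ).1 this
    choose U hU using h1
    exact ⟨Matrix.of U, fun i => by simp [← hU, Int.cast_smul_eq_zsmul]⟩
  obtain ⟨U, hU⟩ := hint b b' h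
  obtain ⟨V, hV⟩ := hint b' b h.symm
  have hVU : V * U = 1 := by
    ext i j
    have h1 : b i = ∑ k, (((V * U) i k : ℤ) : ℝ) • b k := by
      conv_lhs => rw [hV i]
      simp_rw [hU, Finset.smul_sum, smul_smul, Matrix.mul_apply]
      rw [Finset.sum_comm]
      refine Finset.sum_congr rfl fun k _ => ?_
      rw [← Finset.sum_smul]
      push_cast
      rfl
    have h2 := congrArg (fun x => b.repr x j) h1
    simp only [map_sum, map_smul, Module.Basis.repr_self, Finsupp.coe_finsetSum, Finset.sum_apply,
      Finsupp.smul_apply, Finsupp.single_apply, smul_eq_mul, mul_ite, mul_one, mul_zero,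
      Finset.sum_ite_eq', Finset.mem_univ, if_true] at h2
    rw [Matrix.one_apply]
    exact_mod_cast h2.symm
  have hdet : U.det * U.det = 1 := by
    have h1 : V.det * U.det = 1 := by rw [← Matrix.det_mul, hVU, Matrix.det_one]
    rcases Int.isUnit_iff.1 (IsUnit.of_mul_eq_one_right _ h1) with h2 | h2 <;> rw [h2] <;> rfl
  have hgram : (Matrix.of fun i j => inner ℝ (b' i) (b' j))
      = U.map (Int.castRingHom ℝ) * (Matrix.of fun i j => inner ℝ (b i) (b j))
        * (U.map (Int.castRingHom ℝ)).transpose := by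
    ext i j
    simp only [Matrix.of_apply, Matrix.mul_apply, Matrix.transpose_apply, Matrix.map_apply]
    rw [hU i, hU j, inner_sum]
    refine Finset.sum_congr rfl fun l _ => ?_
    rw [sum_inner, Finset.sum_mul]
    refine Finset.sum_congr rfl fun k _ => ?_
    rw [real_inner_smul_left, real_inner_smul_right]
    simp only [Int.coe_castRingHom]
    ring
  rw [hgram, Matrix.det_mul, Matrix.det_mul, Matrix.det_transpose]
  have h3 : (U.map (Int.castRingHom ℝ)).det = (U.det : ℝ) := by
    rw [← RingHom.mapMatrix_apply, ← RingHom.map_det]; rfl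
  have h4 : (U.det : ℝ) * U.det = 1 := by exact_mod_cast hdet
  rw [h3]
  linear_combination (Matrix.of fun i j => inner ℝ (b i) (b j)).det * h4

/-- Elementary divisors of `L` in a lattice `M` of which it is a sublattice. -/
theorem exists_smith_basis (hL : IsLattice L) (hM : IsLattice M) (hLM : L ≤ M) :
    ∃ (m l : Module.Basis (Fin n) ℝ (EuclideanSpace ℝ (Fin n))) (a : Fin n → ℤ),
      Submodule.span ℤ (Set.range m) = M ∧ Submodule.span ℤ (Set.range l) = L ∧
      ∀ i, l i = (a i : ℝ) • m i := by
  obtain ⟨hM1, hM2⟩ := hM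
  obtain ⟨hL1, hL2⟩ := hL
  have : Module.Finite ℤ M := ZLattice.module_finite ℝ M
  have : Module.Free ℤ M := ZLattice.module_free ℝ M
  have hrM : Module.finrank ℤ M = n := by rw [ZLattice.rank ℝ M, finrank_euclideanSpace_fin]
  have hrL : Module.finrank ℤ L = n := by rw [ZLattice.rank ℝ L, finrank_euclideanSpace_fin]
  let e := Submodule.submoduleOfEquivOfLe hLM
  obtain ⟨m, a, l, hl⟩ := Submodule.exists_smith_normal_form_of_rank_eq (N := L.submoduleOf M)
    (Module.finBasisOfFinrankEq ℤ M hrM) (by rw [e.finrank_eq, hrL, hrM])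
  refine ⟨m.ofZLatticeBasis ℝ M, (l.map e).ofZLatticeBasis ℝ L, a, m.ofZLatticeBasis_span ℝ,
    (l.map e).ofZLatticeBasis_span ℝ, fun i => ?_⟩
  rw [Module.Basis.ofZLatticeBasis_apply, Module.Basis.ofZLatticeBasis_apply,
    Int.cast_smul_eq_zsmul]
  exact congrArg (Subtype.val : M → EuclideanSpace ℝ (Fin n)) (hl i)

/-- If a similarity of norm 2 maps `M` onto its sublattice `L`, and `L` contains twice `M` at the
prime 2, then half of the elementary divisors of `L` in `M` are 1, and the others are 2. -/
theorem exists_adapted_basis (hL : IsLattice L) (hM : IsLattice M) (hLM : L ≤ M)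
    {τ : EuclideanSpace ℝ (Fin n) →ₗ[ℝ] EuclideanSpace ℝ (Fin n)} (hτ : MultipliesNormsBy 2 τ)
    (hmap : τ '' (M : Set (EuclideanSpace ℝ (Fin n))) = L)
    (h2 : ∀ x ∈ M, 2 • x ∈ loc 2 Nat.prime_two L) :
    ∃ (h : ℕ) (m : Module.Basis (Fin h ⊕ Fin h) ℝ (EuclideanSpace ℝ (Fin n))), n = 2 * h ∧
      Submodule.span ℤ (Set.range m) = M ∧
      Submodule.span ℤ (Set.range (Sum.elim (fun i => m (Sum.inl i))
        fun j => (2 : ℝ) • m (Sum.inr j))) = L := by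
  obtain ⟨m, l, a, hm, hl, hla⟩ := exists_smith_basis hL hM hLM
  -- Comparing Gram determinants determines the index of `L` in `M`.
  have hinj := injective_of_multipliesNormsBy two_ne_zero hτ
  let t : Module.Basis (Fin n) ℝ (EuclideanSpace ℝ (Fin n)) :=
    m.map (LinearEquiv.ofInjectiveEndo τ hinj)
  have ht : ∀ i, t i = τ (m i) := fun i => by simp [t]
  have hspan : Submodule.span ℤ (Set.range l) = Submodule.span ℤ (Set.range t) := by
    have h1 : Set.range t = (τ.restrictScalars ℤ) '' Set.range m := by
      rw [← Set.range_comp]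
      exact congrArg Set.range (funext ht)
    rw [hl, h1, ← Submodule.map_span, hm]
    exact SetLike.coe_injective (by rw [Submodule.map_coe]; exact hmap.symm)
  have hgram := det_gram_eq_of_span_eq l t hspan
  have hG1 : (Matrix.of fun i j => inner ℝ (t i) (t j))
      = (2 : ℝ) • Matrix.of fun i j => inner ℝ (m i) (m j) := by
    ext i j
    simp [ht, inner_map_map_of_norm hτ]
  have hG2 : (Matrix.of fun i j => inner ℝ (l i) (l j))
      = Matrix.diagonal (fun i => (a i : ℝ)) * (Matrix.of fun i j => inner ℝ (m i) (m j))
        * Matrix.diagonal (fun i => (a i : ℝ)) := by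
    ext i j
    rw [Matrix.mul_diagonal, Matrix.diagonal_mul]
    simp only [Matrix.of_apply]
    rw [hla, hla, real_inner_smul_left, real_inner_smul_right]
    ring
  have hG0 : (Matrix.of fun i j => inner ℝ (m i) (m j) : Matrix (Fin n) (Fin n) ℝ).det ≠ 0 := by
    intro h0
    obtain ⟨v, hv, hv0⟩ := Matrix.exists_vecMul_eq_zero_iff.2 h0
    have h1 : ∑ i, v i • m i = 0 := by
      apply InnerProductSpace.ext_inner_right_basis m
      intro j
      have := congrFun hv0 j
      simp only [Matrix.vecMul, dotProduct, Pi.zero_apply, Matrix.of_apply] at this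
      rw [sum_inner, inner_zero_left]
      simp_rw [real_inner_smul_left]
      exact this
    exact hv (funext (Fintype.linearIndependent_iff.1 m.linearIndependent _ h1))
  rw [hG1, hG2, Matrix.det_smul, Matrix.det_mul, Matrix.det_mul, Matrix.det_diagonal,
    Fintype.card_fin] at hgram
  have hprod : (∏ i, a i) * ∏ i, a i = 2 ^ n := by
    have h1 : (∏ i, (a i : ℝ)) * ∏ i, (a i : ℝ) = 2 ^ n := by
      apply mul_right_cancel₀ hG0
      linear_combination -hgram
    exact_mod_cast h1
  have habs : ∀ i, (a i).natAbs = 1 ∨ (a i).natAbs = 2 := by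
    intro i
    have hd1 : (a i).natAbs ∣ 2 ^ n := by
      have h1 : a i ∣ 2 ^ n :=
        hprod ▸ (Finset.dvd_prod_of_mem a (Finset.mem_univ i)).mul_right _
      have := Int.natAbs_dvd_natAbs.2 h1
      simpa [Int.natAbs_pow] using this
    obtain ⟨j, -, hj⟩ := (Nat.dvd_prime_pow Nat.prime_two).1 hd1
    obtain ⟨k, hk, hkx⟩ := h2 (m i) (hm ▸ Submodule.subset_span ⟨i, rfl⟩)
    -- `2 k mᵢ ∈ L` with `k` odd forces `aᵢ ∣ 2 k`.
    rw [← hl] at hkx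
    obtain ⟨c, hc⟩ := (Submodule.mem_span_range_iff_exists_fun ℤ).1 hkx
    have h3 := congrArg (fun x => m.repr x i) hc
    have h4 : c i * a i = k * 2 := by
      simp only [hla, ← Int.cast_smul_eq_zsmul ℝ, ← Nat.cast_smul_eq_nsmul ℝ, smul_smul, map_sum,
        map_smul, Module.Basis.repr_self, Finsupp.coe_finsetSum, Finset.sum_apply,
        Finsupp.smul_apply, Finsupp.single_apply, smul_eq_mul, mul_ite, mul_one, mul_zero,
        Finset.sum_ite_eq', Finset.mem_univ, if_true] at h3
      exact_mod_cast h3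
    have h5 : (a i).natAbs ∣ k * 2 := by
      rw [← Int.natCast_dvd_natCast, Int.natAbs_dvd]
      exact ⟨c i, by push_cast; rw [← h4, mul_comm]⟩
    rw [hj] at h5 ⊢
    have hj2 : j < 2 := by
      by_contra hge
      have h6 : 2 * 2 ∣ k * 2 := (pow_dvd_pow 2 (not_lt.1 hge)).trans h5
      exact hk (Nat.dvd_of_mul_dvd_mul_right two_pos h6)
    interval_cases j <;> simp
  -- Count the elementary divisors equal to 2.
  have hcount : Fintype.card {i // ¬ (a i).natAbs = 1} * 2 = n := by
    have h1 : ∏ i, (a i).natAbs = 2 ^ Fintype.card {i // ¬ (a i).natAbs = 1} := by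
      rw [← Fintype.prod_subtype_mul_prod_subtype (fun i => (a i).natAbs = 1),
        Finset.prod_congr rfl (fun (i : {i // (a i).natAbs = 1}) _ => i.2),
        Finset.prod_congr rfl (fun (i : {i // ¬ (a i).natAbs = 1}) _ =>
          (habs i.1).resolve_left i.2)]
      simp
    have h3 : (∏ i, (a i).natAbs) * ∏ i, (a i).natAbs = 2 ^ n := by
      have := congrArg Int.natAbsHom hprod
      rw [map_mul, map_prod, map_pow] at this
      exact this
    rw [h1, ← pow_add] at h3
    have := Nat.pow_right_injective le_rfl h3
    omega
  have hcount' : Fintype.card {i // (a i).natAbs = 1} = Fintype.card {i // ¬ (a i).natAbs = 1} := by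
    have := Fintype.card_subtype_compl (fun i => (a i).natAbs = 1)
    have h3 := Fintype.card_subtype_le (fun i => (a i).natAbs = 1)
    rw [Fintype.card_fin] at this h3
    omega
  let h := Fintype.card {i // ¬ (a i).natAbs = 1}
  let e1 : {i // (a i).natAbs = 1} ≃ Fin h := Fintype.equivFinOfCardEq hcount'
  let e2 : {i // ¬ (a i).natAbs = 1} ≃ Fin h := Fintype.equivFin _
  let e : Fin h ⊕ Fin h ≃ Fin n :=
    (Equiv.sumCongr e1.symm e2.symm).trans (Equiv.sumCompl fun i => (a i).natAbs = 1)
  refine ⟨h, m.reindex e.symm, by omega, by rw [Module.Basis.range_reindex, hm], ?_⟩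
  have hel : ∀ i, (a (e (Sum.inl i))).natAbs = 1 := fun i => (e1.symm i).2
  have her : ∀ i, (a (e (Sum.inr i))).natAbs = 2 := fun i => (habs _).resolve_left (e2.symm i).2
  rw [← hl]
  have hsign : ∀ i, ∃ s : ℝ, (s = 1 ∨ s = -1) ∧ (a i : ℝ) = s * (a i).natAbs := by
    intro i
    rcases Int.natAbs_eq (a i) with h1 | h1
    · exact ⟨1, Or.inl rfl, by
        rw [one_mul]
        exact congrArg (Int.cast : ℤ → ℝ) h1⟩
    · exact ⟨-1, Or.inr rfl, by
        rw [neg_one_mul]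
        exact (congrArg (Int.cast : ℤ → ℝ) h1).trans (Int.cast_neg _)⟩
  have hcases : ∀ x, ∃ s : ℝ, (s = 1 ∨ s = -1) ∧ l (e x) = s • (Sum.elim (fun i => m.reindex e.symm
      (Sum.inl i)) (fun j => (2 : ℝ) • m.reindex e.symm (Sum.inr j))) x := by
    intro x
    obtain ⟨s, hs, hsa⟩ := hsign (e x)
    refine ⟨s, hs, ?_⟩
    rw [hla, hsa]
    rcases x with i | i
    · rw [hel]; simp
    · rw [her]; simp [smul_smul]
  apply le_antisymm
  · rw [Submodule.span_le]
    rintro _ ⟨x, rfl⟩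
    obtain ⟨s, hs | hs, hsx⟩ := hcases x
    · rw [hs, one_smul] at hsx
      rw [← hsx]
      exact Submodule.subset_span ⟨_, rfl⟩
    · rw [hs, neg_one_smul, eq_neg_iff_add_eq_zero, add_comm, ← eq_neg_iff_add_eq_zero] at hsx
      rw [hsx]
      exact neg_mem (Submodule.subset_span ⟨_, rfl⟩)
  · rw [Submodule.span_le]
    rintro _ ⟨i, rfl⟩
    obtain ⟨x, rfl⟩ := e.surjective i
    obtain ⟨s, hs | hs, hsx⟩ := hcases x
    · rw [hsx, hs, one_smul]
      exact Submodule.subset_span ⟨x, rfl⟩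
    · rw [hsx, hs, neg_one_smul]
      exact neg_mem (Submodule.subset_span ⟨x, rfl⟩)

end Adapted

/-! ### The congruence between characteristic vectors -/

section Pairing

variable {n h : ℕ} {L M : Submodule ℤ (EuclideanSpace ℝ (Fin n))}
  {m : Module.Basis (Fin h ⊕ Fin h) ℝ (EuclideanSpace ℝ (Fin n))}

/-- The basis of `L` attached to an adapted basis `m` of `M`. -/
noncomputable def adaptedVec (m : Module.Basis (Fin h ⊕ Fin h) ℝ (EuclideanSpace ℝ (Fin n))) :
    Fin h ⊕ Fin h → EuclideanSpace ℝ (Fin n) :=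
  Sum.elim (fun i => m (Sum.inl i)) fun j => (2 : ℝ) • m (Sum.inr j)

/-- The pairing matrix of the lattice spanned by `adaptedVec m` with the one spanned by `m`. -/
def pairing (P Q R : Matrix (Fin h) (Fin h) ℤ) : Matrix (Fin h ⊕ Fin h) (Fin h ⊕ Fin h) ℤ :=
  Matrix.fromBlocks P Q ((2 : ℤ) • Q.transpose) R

/-- The matrices `P`, `Q`, `R / 2` are the blocks of the Gram matrix of `m`. -/
structure IsGram (m : Module.Basis (Fin h ⊕ Fin h) ℝ (EuclideanSpace ℝ (Fin n)))
    (P Q R : Matrix (Fin h) (Fin h) ℤ) : Prop where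
  ll : ∀ i j, inner ℝ (m (Sum.inl i)) (m (Sum.inl j)) = P i j
  lr : ∀ i j, inner ℝ (m (Sum.inl i)) (m (Sum.inr j)) = Q i j
  rr : ∀ i j, 2 * inner ℝ (m (Sum.inr i)) (m (Sum.inr j)) = R i j

variable {P Q R : Matrix (Fin h) (Fin h) ℤ}

theorem IsGram.rl (hg : IsGram m P Q R) (i j : Fin h) :
    inner ℝ (m (Sum.inr i)) (m (Sum.inl j)) = Q j i := by
  rw [real_inner_comm, hg.lr]

theorem IsGram.isSymm_left (hg : IsGram m P Q R) : P.IsSymm := by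
  ext i j
  have : (P j i : ℝ) = P i j := by rw [← hg.ll, ← hg.ll, real_inner_comm]
  exact_mod_cast this

theorem IsGram.isSymm_right (hg : IsGram m P Q R) : R.IsSymm := by
  ext i j
  have : (R j i : ℝ) = R i j := by rw [← hg.rr, ← hg.rr, real_inner_comm]
  exact_mod_cast this

theorem IsGram.inner_adaptedVec (hg : IsGram m P Q R) (x y : Fin h ⊕ Fin h) :
    inner ℝ (adaptedVec m x) (m y) = pairing P Q R x y := by
  rcases x with i | i <;> rcases y with j | j
  · simpa [adaptedVec, pairing] using hg.ll i j
  · simpa [adaptedVec, pairing] using hg.lr i j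
  · have h1 : pairing P Q R (Sum.inr i) (Sum.inl j) = 2 * Q j i := rfl
    rw [h1]
    simpa [adaptedVec, real_inner_smul_left] using hg.rl i j
  · simpa [adaptedVec, pairing, real_inner_smul_left] using hg.rr i j

/-- Integrality at `p` of inner products with a lattice can be tested on a basis. -/
theorem isPInt_inner_of_span {p : ℕ} (hp : p.Prime) {ι : Type*} {v : ι → EuclideanSpace ℝ (Fin n)}
    {x : EuclideanSpace ℝ (Fin n)} (hx : ∀ i, IsPInt p (inner ℝ x (v i)))
    {d : EuclideanSpace ℝ (Fin n)} (hd : d ∈ loc p hp (Submodule.span ℤ (Set.range v))) :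
    IsPInt p (inner ℝ x d) := by
  obtain ⟨k, hk, hkd⟩ := hd
  refine IsPInt.of_nat_mul hp hk ?_
  rw [real_inner_comm, ← inner_nsmul_left', real_inner_comm]
  generalize k • d = e at hkd
  induction hkd using Submodule.span_induction with
  | mem u hu =>
    obtain ⟨i, rfl⟩ := hu
    exact hx i
  | zero => rw [inner_zero_right]; exact IsPInt.zero hp
  | add v w _ _ hv hw => rw [inner_add_right]; exact hv.add hp hw
  | smul a v _ hv =>
    rw [← Int.cast_smul_eq_zsmul ℝ, real_inner_smul_right]; exact hv.int_mul a

theorem linearIndependent_adaptedVec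
    (m : Module.Basis (Fin h ⊕ Fin h) ℝ (EuclideanSpace ℝ (Fin n))) :
    LinearIndependent ℝ (adaptedVec m) := by
  let w : Fin h ⊕ Fin h → ℝˣ := Sum.elim (fun _ => 1) fun _ => Units.mk0 2 two_ne_zero
  have : adaptedVec m = m.unitsSMul w := by
    ext1 x
    rcases x with i | i <;> simp [adaptedVec, w, Module.Basis.unitsSMul_apply, Units.smul_def]
  rw [this]
  exact (m.unitsSMul w).linearIndependent

/-- The pairing between `L` and its dual is perfect at 2. -/
theorem odd_det_pairing (hL : IsLattice L)
    (hM2 : loc 2 Nat.prime_two M = loc 2 Nat.prime_two (dual L))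
    (hm : Submodule.span ℤ (Set.range m) = M)
    (hgL : Submodule.span ℤ (Set.range (adaptedVec m)) = L) (hg : IsGram m P Q R) :
    Odd (pairing P Q R).det := by
  rw [← Int.not_even_iff_odd, even_iff_two_dvd]
  intro hev
  have h0 : ((pairing P Q R).map (Int.castRingHom (ZMod 2))).det = 0 := by
    rw [← RingHom.mapMatrix_apply, ← RingHom.map_det]
    exact (ZMod.intCast_zmod_eq_zero_iff_dvd _ 2).2 (by exact_mod_cast hev)
  obtain ⟨v, hv, hv0⟩ := Matrix.exists_vecMul_eq_zero_iff.2 h0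
  choose w hw using fun x => ZMod.intCast_surjective (v x)
  let u := ∑ x, (w x : ℝ) • adaptedVec m x
  -- The vector `u / 2` pairs integrally with the dual of `L`, hence lies in `L` at 2.
  have hu : (1 / 2 : ℝ) • u ∈ loc 2 Nat.prime_two L := by
    rw [mem_loc_iff_loc_dual hL, ← hM2, ← hm]
    intro d hd
    refine isPInt_inner_of_span Nat.prime_two (fun y => ?_) hd
    have h1 : (2 : ℤ) ∣ ∑ x, w x * pairing P Q R x y := by
      have h2 := congrFun hv0 y
      simp only [Matrix.vecMul, dotProduct, Pi.zero_apply, Matrix.map_apply, ← hw] at h2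
      have h3 : ((∑ x, w x * pairing P Q R x y : ℤ) : ZMod 2) = 0 := by
        push_cast
        exact h2
      exact_mod_cast (ZMod.intCast_zmod_eq_zero_iff_dvd _ 2).1 h3
    obtain ⟨k, hk⟩ := h1
    have h4 : inner ℝ ((1 / 2 : ℝ) • u) (m y) = k := by
      rw [real_inner_smul_left, sum_inner]
      simp_rw [real_inner_smul_left, hg.inner_adaptedVec]
      have : (∑ x, (w x : ℝ) * (pairing P Q R x y : ℤ)) = 2 * k := by exact_mod_cast hk
      rw [this]; ring
    rw [h4]
    exact IsPInt.intCast Nat.prime_two k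
  obtain ⟨k, hk, hku⟩ := hu
  rw [← hgL] at hku
  obtain ⟨c, hc⟩ := (Submodule.mem_span_range_iff_exists_fun ℤ).1 hku
  refine hv (funext fun x => ?_)
  have h5 : ∑ x, ((c x : ℝ) - k * (1 / 2) * w x) • adaptedVec m x = 0 := by
    simp_rw [sub_smul, Finset.sum_sub_distrib, sub_eq_zero, Int.cast_smul_eq_zsmul, hc, mul_smul,
      ← Finset.smul_sum, u, Nat.cast_smul_eq_nsmul]
  have h6 := Fintype.linearIndependent_iff.1 (linearIndependent_adaptedVec m) _ h5 x
  have h7 : 2 * c x = k * w x := by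
    have : (2 : ℝ) * c x = k * w x := by linear_combination 2 * h6
    exact_mod_cast this
  rw [← hw, Pi.zero_apply, ZMod.intCast_zmod_eq_zero_iff_dvd]
  have h8 : (2 : ℤ) ∣ k * w x := ⟨_, h7.symm⟩
  rcases Int.prime_two.dvd_or_dvd h8 with h9 | h9
  · exact absurd (by exact_mod_cast h9) hk
  · exact_mod_cast h9

/-- The condition on the oddity says that the odd part of the determinant is 1 modulo 4. -/
theorem det_pairing_eq_one (hn : 4 ∣ n) (hnh : n = 2 * h)
    (hgL : Submodule.span ℤ (Set.range (adaptedVec m)) = L) (hg : IsGram m P Q R)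
    (hE : Odd (pairing P Q R).det) {o : ZMod 8} (ho : HasOddity L o) (ho4 : o = 0 ∨ o = 4) :
    (((pairing P Q R).det : ℤ) : ZMod 4) = 1 := by
  obtain ⟨e, q, heL, he0, horth, hq, rfl⟩ := ho
  have hq0 : ∀ i, q i ≠ 0 := by
    intro i h0
    have := hq i
    rw [h0, Rat.cast_zero, inner_self_eq_zero] at this
    exact he0 i this
  have hone := oddPartModFour_prod_eq_one hn q hq0 ho4
  let ε : Fin h ⊕ Fin h ≃ Fin n := finSumFinEquiv.trans (finCongr (by omega))
  -- Rational coordinates of the orthogonal vectors with respect to the basis of `L`.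
  have hcoord : ∀ x, ∃ c : Fin h ⊕ Fin h → ℚ, e (ε x) = ∑ y, (c y : ℝ) • adaptedVec m y := by
    intro x
    obtain ⟨k, hk, hkx⟩ := exists_nsmul_mem_of_mem_ratSpan (heL (ε x))
    rw [← hgL] at hkx
    obtain ⟨c, hc⟩ := (Submodule.mem_span_range_iff_exists_fun ℤ).1 hkx
    refine ⟨fun y => c y / k, ?_⟩
    have hk0 : (k : ℝ) ≠ 0 := Nat.cast_ne_zero.2 hk
    have h1 : e (ε x) = (k : ℝ)⁻¹ • k • e (ε x) := by
      rw [← Nat.cast_smul_eq_nsmul ℝ, smul_smul, inv_mul_cancel₀ hk0, one_smul]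
    rw [h1, ← hc, Finset.smul_sum]
    refine Finset.sum_congr rfl fun y _ => ?_
    rw [← Int.cast_smul_eq_zsmul ℝ, smul_smul]
    congr 1
    push_cast
    ring
  choose C hC using hcoord
  let F : Matrix (Fin h ⊕ Fin h) (Fin h ⊕ Fin h) ℤ := 
    Matrix.diagonal (Sum.elim (fun _ => 1) fun _ => 2)
  have hgram : ∀ x y, inner ℝ (adaptedVec m x) (adaptedVec m y)
      = (((pairing P Q R * F) x y : ℤ) : ℝ) := by
    intro x y
    rw [Matrix.mul_diagonal]
    rcases y with j | j
    · simpa [adaptedVec] using hg.inner_adaptedVec x (Sum.inl j)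
    · have h2 : inner ℝ (adaptedVec m x) (adaptedVec m (Sum.inr j))
          = 2 * inner ℝ (adaptedVec m x) (m (Sum.inr j)) := by
        rw [← real_inner_smul_right]; rfl
      rw [h2, hg.inner_adaptedVec]
      push_cast
      exact mul_comm _ _
  have hF : F.det = 2 ^ h := by simp [F]
  let G : Matrix (Fin h ⊕ Fin h) (Fin h ⊕ Fin h) ℚ := (pairing P Q R * F).map (Int.castRingHom ℚ)
  have hdiag : Matrix.diagonal (fun x => q (ε x)) = Matrix.of C * G * (Matrix.of C).transpose := by
    ext x y
    have h1 : ((Matrix.diagonal (fun x => q (ε x)) x y : ℚ) : ℝ) = inner ℝ (e (ε x)) (e (ε y)) := by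
      rw [Matrix.diagonal_apply]
      split_ifs with hxy
      · rw [hxy, hq]
      · rw [horth _ _ fun h => hxy (ε.injective h), Rat.cast_zero]
    have h2 : inner ℝ (e (ε x)) (e (ε y))
        = (((Matrix.of C * G * (Matrix.of C).transpose) x y : ℚ) : ℝ) := by
      rw [hC x, hC y, inner_sum, Matrix.mul_apply]
      push_cast
      refine Finset.sum_congr rfl fun l _ => ?_
      rw [sum_inner, Matrix.mul_apply]
      push_cast
      rw [Finset.sum_mul]
      refine Finset.sum_congr rfl fun k _ => ?_
      rw [real_inner_smul_left, real_inner_smul_right, hgram]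
      simp only [G, Matrix.of_apply, Matrix.transpose_apply, Matrix.map_apply, Int.coe_castRingHom,
        Rat.cast_intCast]
      ring
    exact_mod_cast h1.trans h2
  have hdet : ∏ i, q i
      = ((Matrix.of C).det * (Matrix.of C).det) * (2 ^ h * ((pairing P Q R).det : ℤ)) := by
    have hGdet : G.det = 2 ^ h * ((pairing P Q R).det : ℤ) := by
      have : G.det = (((pairing P Q R * F).det : ℤ) : ℚ) := by
        simp only [G]
        rw [← RingHom.mapMatrix_apply, ← RingHom.map_det]
        rfl
      rw [this, Matrix.det_mul, hF]
      push_cast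
      ring
    rw [← Equiv.prod_comp ε, ← Matrix.det_diagonal, hdiag, Matrix.det_mul, Matrix.det_mul,
      Matrix.det_transpose, hGdet]
    ring
  have hprod0 : ∏ i, q i ≠ 0 := Finset.prod_ne_zero_iff.2 fun i _ => hq0 i
  rw [hdet] at hprod0 hone
  have hC0 := left_ne_zero_of_mul (left_ne_zero_of_mul hprod0)
  rw [oddPartModFour_mul (mul_ne_zero hC0 hC0) (right_ne_zero_of_mul hprod0),
    oddPartModFour_mul hC0 hC0, oddPartModFour_mul_self hC0, one_mul,
    oddPartModFour_two_pow_mul hE] at hone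
  exact hone

end Pairing

section CharVectors

variable {n h : ℕ} {L M : Submodule ℤ (EuclideanSpace ℝ (Fin n))}
  {m : Module.Basis (Fin h ⊕ Fin h) ℝ (EuclideanSpace ℝ (Fin n))}
  {P Q R : Matrix (Fin h) (Fin h) ℤ}

/-- Integral version of `exists_char_vectors_of_det_eq_one`. -/
theorem exists_int_char_vectors (hP : P.IsSymm) (hR : R.IsSymm)
    (hE : (((pairing P Q R).det : ℤ) : ZMod 4) = 1) (hh : Even h) :
    ∃ x y z : Fin h → ℤ, (∀ i, (4 : ℤ) ∣ ∑ j, P i j * x j - P i i) ∧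
      (∀ i, (4 : ℤ) ∣ ∑ j, P i j * y j + ∑ j, Q i j * z j) ∧
      (∀ j, (2 : ℤ) ∣ 2 * ∑ i, Q i j * y i + ∑ i, R j i * z i - R j j) ∧
      (2 : ℤ) ∣ ∑ i, P i i * x i ∧
      (4 : ℤ) ∣ ∑ i, P i i * x i + ∑ j, z j * (2 * ∑ i, Q i j * y i + ∑ i, R j i * z i) := by
  let φ := Int.castRingHom (ZMod 4)
  have hE' : (Matrix.fromBlocks (P.map φ) (Q.map φ) ((2 : ZMod 4) • (Q.map φ).transpose)
      (R.map φ)).det = 1 := by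
    have h1 : Matrix.fromBlocks (P.map φ) (Q.map φ) ((2 : ZMod 4) • (Q.map φ).transpose)
        (R.map φ) = (pairing P Q R).map φ := by
      rw [pairing, Matrix.fromBlocks_map]
      congr 1
      ext i j
      exact (Int.cast_mul 2 (Q j i)).symm
    rw [h1, ← RingHom.mapMatrix_apply, ← RingHom.map_det]
    exact hE
  obtain ⟨k, hk⟩ := hh
  have hcard : Fintype.card (Fin h) = 2 * k := by rw [Fintype.card_fin]; omega
  obtain ⟨x, y, z, h1, h2, h3, h4, h5⟩ := exists_char_vectors_of_det_eq_one (P.map φ) (Q.map φ)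
    (R.map φ) (by rw [Matrix.IsSymm, ← Matrix.transpose_map, hP])
    (by rw [Matrix.IsSymm, ← Matrix.transpose_map, hR]) hE' k k hcard hcard ⟨k, rfl⟩
  choose x' hx using fun i => ZMod.intCast_surjective (x i)
  choose y' hy using fun i => ZMod.intCast_surjective (y i)
  choose z' hz using fun i => ZMod.intCast_surjective (z i)
  have hdvd : ∀ a : ℤ, (a : ZMod 4) = 0 → (4 : ℤ) ∣ a := fun a ha => by
    exact_mod_cast (ZMod.intCast_zmod_eq_zero_iff_dvd a 4).1 ha
  have hdvd2 : ∀ a : ℤ, (2 : ZMod 4) * a = 0 → (2 : ℤ) ∣ a := fun a ha => by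
    have := hdvd (2 * a) (by push_cast; exact ha)
    omega
  refine ⟨x', y', z', fun i => hdvd _ ?_, fun i => hdvd _ ?_, fun j => hdvd2 _ ?_, hdvd2 _ ?_,
    hdvd _ ?_⟩
  · have := congrFun h1 i
    simp only [Matrix.mulVec, dotProduct, Matrix.map_apply, Matrix.diag_apply, φ,
      Int.coe_castRingHom, ← hx] at this
    push_cast
    rw [this, sub_self]
  · have := congrFun h2 i
    simp only [Matrix.mulVec, dotProduct, Matrix.map_apply, φ, Pi.add_apply, Pi.zero_apply,
      Int.coe_castRingHom, ← hy, ← hz] at this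
    push_cast
    exact this
  · have := h3 j
    simp only [Matrix.mulVec, dotProduct, Matrix.map_apply, φ, Pi.add_apply, Pi.smul_apply,
      smul_eq_mul, Matrix.transpose_apply, Int.coe_castRingHom, ← hy, ← hz] at this
    push_cast
    exact this
  · simp only [dotProduct, Matrix.map_apply, Matrix.diag_apply, φ, Int.coe_castRingHom, ← hx] at h4
    push_cast
    exact h4
  · simp only [Matrix.mulVec, dotProduct, Matrix.map_apply, Matrix.diag_apply, φ, Pi.add_apply,
      Pi.smul_apply, smul_eq_mul, Matrix.transpose_apply, Int.coe_castRingHom, ← hx, ← hy, ← hz]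
      at h5
    push_cast
    exact h5

/-- A congruence `u·u ≡ c·u` holds on a lattice at 2 if it holds on a basis: the difference is
additive up to the even number `2 u·v`. The factor `a` is 1 or `1 / 2`. -/
theorem char_mem_of_span {ι : Type*} {v : ι → EuclideanSpace ℝ (Fin n)}
    {A : Submodule ℤ (EuclideanSpace ℝ (Fin n))} {c : EuclideanSpace ℝ (Fin n)} {a : ℝ}
    (hA : loc 2 Nat.prime_two (Submodule.span ℤ (Set.range v)) = A)
    (h2 : ∀ u ∈ A, ∀ w ∈ A, a * (2 * inner ℝ u w) ∈ twoIntegers)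
    (hc : ∀ u ∈ A, a * (2 * inner ℝ c u) ∈ twoIntegers)
    (hv : ∀ i, a * (inner ℝ (v i) (v i) - inner ℝ c (v i)) ∈ twoIntegers) :
    ∀ u ∈ A, a * (inner ℝ u u - inner ℝ c u) ∈ twoIntegers := by
  have hspan : ∀ u ∈ Submodule.span ℤ (Set.range v), u ∈ A ∧
      a * (inner ℝ u u - inner ℝ c u) ∈ twoIntegers := by
    intro u hu
    refine ⟨hA ▸ le_loc hu, ?_⟩
    induction hu using Submodule.span_induction with
    | mem u hu =>
      obtain ⟨i, rfl⟩ := hu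
      exact hv i
    | zero => simp
    | add u w hu hw hu' hw' =>
      convert add_mem (add_mem hu' hw') (h2 u (hA ▸ le_loc hu) w (hA ▸ le_loc hw)) using 1
      rw [real_inner_add_add_self, inner_add_right]; ring
    | smul k u hu hu' =>
      -- `k² u·u - k c·u = k² (u·u - c·u) + (k² - k) c·u`, and `k² - k` is even.
      obtain ⟨l, hl⟩ := (Int.even_mul_succ_self (k - 1))
      have hl' : (k : ℝ) * k - k = l + l := by
        have : k * k - k = l + l := by rw [← hl]; ring
        exact_mod_cast this
      convert add_mem (int_mul_mem (k * k) hu') (int_mul_mem l (hc u (hA ▸ le_loc hu))) using 1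
      rw [← Int.cast_smul_eq_zsmul ℝ, real_inner_smul_right, real_inner_smul_left,
        real_inner_smul_right]
      push_cast
      linear_combination (a * inner ℝ c u) * hl'
  intro u hu
  obtain ⟨k, hk, hku⟩ : u ∈ loc 2 Nat.prime_two (Submodule.span ℤ (Set.range v)) := hA.symm ▸ hu
  have h1 := (hspan _ hku).2
  rw [inner_nsmul_left', real_inner_comm, inner_nsmul_left', real_inner_comm _ c,
    inner_nsmul_left', real_inner_comm] at h1
  obtain ⟨l, hl⟩ := Nat.even_mul_succ_self (k - 1)
  have hk0 : k ≠ 0 := by rintro rfl; exact hk (dvd_zero 2)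
  have hl' : (k : ℝ) * k - k = l + l := by
    have : k * k = l + l + k := by
      obtain ⟨j, rfl⟩ := Nat.exists_eq_succ_of_ne_zero hk0
      simp only [Nat.succ_eq_add_one, Nat.add_sub_cancel] at hl ⊢
      linarith
    have : (k : ℝ) * k = l + l + k := by exact_mod_cast this
    linarith
  refine IsPInt.of_nat_mul Nat.prime_two (k := k * k) (fun hd => hk ?_) ?_
  · exact or_self_iff.1 ((Nat.prime_two.dvd_mul).1 hd)
  · change _ ∈ twoIntegers
    convert sub_mem h1 (int_mul_mem l (hc u hu)) using 1
    push_cast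
    linear_combination (-a * inner ℝ c u) * hl' - (a * k) * real_inner_comm u c

/-- The hypotheses on dimension and oddity provide characteristic vectors satisfying the key
congruence. -/
theorem exists_localSetup (hL : IsIntegral L) (hodd : ∃ u ∈ L, inner ℝ u u / 2 ∉ twoIntegers)
    (hn : 4 ∣ n) {o : ZMod 8} (ho : HasOddity L o) (ho4 : o = 0 ∨ o = 4)
    {τ : EuclideanSpace ℝ (Fin n) →ₗ[ℝ] EuclideanSpace ℝ (Fin n)} (hτ : MultipliesNormsBy 2 τ)
    {S : Set Nat.Primes} (hS : (⟨2, Nat.prime_two⟩ : Nat.Primes) ∈ S)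
    (hmap : τ '' (piDual S L : Set (EuclideanSpace ℝ (Fin n))) = L) :
    ∃ c c', LocalSetup (loc 2 Nat.prime_two L) (loc 2 Nat.prime_two (dual L)) c c' := by
  have hrat := hL.isRational
  have hLd : L ≤ dual L := fun u hu => mem_dual_iff.2 fun v hv => hL.integral u hu v hv
  set A := loc 2 Nat.prime_two L with hA
  set D := loc 2 Nat.prime_two (dual L) with hD
  have hAD : A ≤ D := loc_mono hLd
  have hinj := injective_of_multipliesNormsBy two_ne_zero hτ
  have hsurj : Function.Surjective τ := LinearMap.injective_iff_surjective.1 hinj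
  have hMD : loc 2 Nat.prime_two (piDual S L) = D := loc_piDual_of_mem hrat hS
  have hτmap : ∀ x, x ∈ D ↔ τ x ∈ A := fun x => by
    rw [← hMD]; exact mem_loc_piDual_iff_map_mem hinj hmap x
  have memD : ∀ x, x ∈ D ↔ ∀ u ∈ A, inner ℝ x u ∈ twoIntegers := fun x =>
    mem_loc_dual_iff_loc hL.isLattice
  have memA : ∀ x, x ∈ A ↔ ∀ u ∈ D, inner ℝ x u ∈ twoIntegers := fun x =>
    mem_loc_iff_loc_dual hL.isLattice
  have htwo : ∀ d ∈ D, ∀ e ∈ D, 2 * inner ℝ d e ∈ twoIntegers := by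
    intro d hd e he
    rw [← inner_map_map_of_norm hτ]
    exact (memD _).1 (hAD ((hτmap d).1 hd)) _ ((hτmap e).1 he)
  set M := piDual S L with hM
  have hLM : L ≤ M := fun x hx =>
    (mem_piDual_iff hrat).2 ⟨fun p _ => le_loc (hLd hx), fun p _ => le_loc hx⟩
  have hMd : M ≤ dual L := fun x hx => mem_of_forall_mem_loc hL.isLattice.dual fun p hp => by
    by_cases hp' : (⟨p, hp⟩ : Nat.Primes) ∈ S
    · exact ((mem_piDual_iff hrat).1 hx).1 _ hp'
    · exact loc_mono hLd (((mem_piDual_iff hrat).1 hx).2 _ hp')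
  obtain ⟨h, m, hnh, hm, hgL⟩ := exists_adapted_basis hL.isLattice (hrat.piDual S).isLattice hLM hτ
    hmap (fun x hx => by
      change 2 • x ∈ A
      rw [memA]
      intro u hu
      rw [inner_nsmul_left']
      exact_mod_cast htwo x (hMD ▸ le_loc hx) u hu)
  change Submodule.span ℤ (Set.range (adaptedVec m)) = L at hgL
  have hlL : ∀ x, adaptedVec m x ∈ L := fun x => hgL ▸ Submodule.subset_span ⟨x, rfl⟩
  have hmM : ∀ x, m x ∈ M := fun x => by
    rw [hM, ← hm]; exact Submodule.subset_span ⟨x, rfl⟩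
  have hint : ∀ x y, ∃ k : ℤ, inner ℝ (adaptedVec m x) (m y) = k := fun x y => by
    rw [real_inner_comm]
    exact mem_dual_iff.1 (hMd (hmM y)) _ (hlL x)
  choose P hP using fun i j => hint (Sum.inl i) (Sum.inl j)
  choose Q hQ using fun i j => hint (Sum.inl i) (Sum.inr j)
  choose R hR using fun i j => hint (Sum.inr i) (Sum.inr j)
  have hg : IsGram m (Matrix.of P) (Matrix.of Q) (Matrix.of R) :=
    ⟨hP, hQ, fun i j => by rw [← real_inner_smul_left]; exact hR i j⟩
  have hE := odd_det_pairing hL.isLattice hMD hm hgL hg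
  have hE1 := det_pairing_eq_one hn hnh hgL hg hE ho ho4
  obtain ⟨x, y, z, h1, h2, h3, h4, h5⟩ := exists_int_char_vectors hg.isSymm_left hg.isSymm_right hE1
    (by rw [even_iff_two_dvd]; omega)
  simp only [Matrix.of_apply] at h1 h2 h3 h4 h5
  choose k1 hk1 using h1
  choose k2 hk2 using h2
  choose k3 hk3 using h3
  obtain ⟨k4, hk4⟩ := h4
  obtain ⟨k5, hk5⟩ := h5
  have hPs : ∀ i j, P i j = P j i := fun i j => hg.isSymm_left.apply j i
  have hRs : ∀ i j, R i j = R j i := fun i j => hg.isSymm_right.apply j i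
  let c : EuclideanSpace ℝ (Fin n) := ∑ i, x i • m (Sum.inl i)
  let c' : EuclideanSpace ℝ (Fin n) := ∑ i, y i • m (Sum.inl i) + ∑ j, z j • m (Sum.inr j)
  have inner_zsmul_sum : ∀ (w : Fin h → ℤ) (f : Fin h → EuclideanSpace ℝ (Fin n)) v,
      inner ℝ (∑ i, w i • f i) v = ∑ i, (w i : ℝ) * inner ℝ (f i) v := by
    intro w f v
    rw [sum_inner]
    refine Finset.sum_congr rfl fun i _ => ?_
    rw [← Int.cast_smul_eq_zsmul ℝ, real_inner_smul_left]
  -- The inner products of the two vectors with the basis.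
  have hc1 : ∀ j, inner ℝ c (m (Sum.inl j)) = P j j + 4 * k1 j := by
    intro j
    rw [inner_zsmul_sum]
    simp_rw [hg.ll, Matrix.of_apply]
    have : ∑ i, x i * P i j = P j j + 4 * k1 j := by
      rw [← hk1 j, Finset.sum_congr rfl fun i _ => by rw [hPs i j, mul_comm]]; ring
    exact_mod_cast this
  have hc2 : ∀ j, inner ℝ c (m (Sum.inr j)) = ((∑ i, x i * Q i j : ℤ) : ℝ) := by
    intro j
    rw [inner_zsmul_sum]
    simp_rw [hg.lr, Matrix.of_apply]
    push_cast
    rfl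
  have hc'1 : ∀ j, inner ℝ c' (m (Sum.inl j)) = 4 * k2 j := by
    intro j
    rw [inner_add_left, inner_zsmul_sum, inner_zsmul_sum]
    simp_rw [hg.ll, hg.rl, Matrix.of_apply]
    have : ∑ i, y i * P i j + ∑ i, z i * Q j i = 4 * k2 j := by
      rw [← hk2 j]
      congr 1
      · exact Finset.sum_congr rfl fun i _ => by rw [hPs i j, mul_comm]
      · exact Finset.sum_congr rfl fun i _ => mul_comm _ _
    exact_mod_cast this
  have hc'2 : ∀ j, 2 * inner ℝ c' (m (Sum.inr j)) = R j j + 2 * k3 j := by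
    intro j
    rw [inner_add_left, inner_zsmul_sum, inner_zsmul_sum, mul_add, Finset.mul_sum _ _ (2 : ℝ),
      Finset.mul_sum _ _ (2 : ℝ)]
    simp_rw [mul_left_comm (2 : ℝ), hg.rr, hg.lr, Matrix.of_apply]
    have : ∑ i, y i * (2 * Q i j) + ∑ i, z i * R i j = R j j + 2 * k3 j := by
      rw [← hk3 j, Finset.mul_sum]
      have e1 : ∑ i, y i * (2 * Q i j) = ∑ i, 2 * (Q i j * y i) :=
        Finset.sum_congr rfl fun i _ => by ring
      have e2 : ∑ i, z i * R i j = ∑ i, R j i * z i :=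
        Finset.sum_congr rfl fun i _ => by rw [hRs i j, mul_comm]
      rw [e1, e2]; ring
    exact_mod_cast this
  -- The norms of the two vectors and their inner product.
  have hcc : inner ℝ c c = 2 * k4 + 4 * ((∑ i, x i * k1 i : ℤ) : ℝ) := by
    conv_lhs => rw [inner_zsmul_sum]
    simp_rw [real_inner_comm c, hc1]
    have : ∑ i, x i * (P i i + 4 * k1 i) = 2 * k4 + 4 * ∑ i, x i * k1 i := by
      rw [← hk4, Finset.mul_sum, ← Finset.sum_add_distrib]
      exact Finset.sum_congr rfl fun i _ => by ring
    exact_mod_cast this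
  have hcc' : inner ℝ c c' = 4 * ((∑ i, x i * k2 i : ℤ) : ℝ) := by
    rw [inner_zsmul_sum]
    simp_rw [real_inner_comm c', hc'1]
    push_cast
    rw [Finset.mul_sum]
    exact Finset.sum_congr rfl fun i _ => by ring
  have hc'c' : 2 * inner ℝ c' c' = 8 * ((∑ i, y i * k2 i : ℤ) : ℝ) + (4 * k5 - 2 * k4) := by
    conv_lhs => rw [inner_add_left, inner_zsmul_sum, inner_zsmul_sum]
    simp_rw [real_inner_comm c', hc'1]
    rw [mul_add, Finset.mul_sum _ _ (2 : ℝ), Finset.mul_sum _ _ (2 : ℝ)]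
    simp_rw [mul_left_comm (2 : ℝ) (z _ : ℝ), hc'2]
    have h6 : ∑ i, z i * (R i i + 2 * k3 i) = 4 * k5 - 2 * k4 := by
      rw [← hk5, ← hk4, add_sub_cancel_left]
      exact Finset.sum_congr rfl fun i _ => by rw [← hk3 i]; ring
    have h7 : ∑ i, (z i : ℝ) * ((R i i : ℝ) + 2 * k3 i) = 4 * k5 - 2 * k4 := by exact_mod_cast h6
    rw [h7]
    push_cast
    rw [Finset.mul_sum]
    congr 1
    exact Finset.sum_congr rfl fun i _ => by ring
  have hcA : c ∈ A := le_loc (sum_mem fun i _ => L.smul_mem _ (hlL (Sum.inl i)))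
  have hcD : c' ∈ D := by
    rw [← hMD]
    exact le_loc (add_mem (sum_mem fun i _ => M.smul_mem _ (hmM _))
      (sum_mem fun i _ => M.smul_mem _ (hmM _)))
  have hZ : ∀ k : ℤ, (k : ℝ) ∈ twoIntegers := fun k => IsPInt.intCast Nat.prime_two k
  have hchar := char_mem_of_span (a := 1 / 2) (c := c) (by rw [hgL])
    (fun u hu w hw => by
      convert (memD u).1 (hAD hu) w hw using 1; ring)
    (fun u hu => by convert (memD c).1 (hAD hcA) u hu using 1; ring)
    (by
      rintro (i | j)
      · convert hZ (-2 * k1 i) using 1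
        change 1 / 2 * (inner ℝ (m (Sum.inl i)) (m (Sum.inl i)) - inner ℝ c (m (Sum.inl i))) = _
        rw [hc1, hg.ll, Matrix.of_apply]
        push_cast; ring
      · convert hZ (R j j - ∑ i, x i * Q i j) using 1
        change 1 / 2 * (inner ℝ ((2 : ℝ) • m (Sum.inr j)) ((2 : ℝ) • m (Sum.inr j))
          - inner ℝ c ((2 : ℝ) • m (Sum.inr j))) = _
        have := hg.rr j j
        rw [Matrix.of_apply] at this
        rw [real_inner_smul_right, real_inner_smul_left, real_inner_smul_right, hc2, Int.cast_sub,
          ← this]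
        ring)
  have hchar' := char_mem_of_span (A := D) (a := 1) (c := c') (by rw [hm, hMD])
    (fun u hu w hw => by rw [one_mul]; exact htwo u hu w hw)
    (fun u hu => by rw [one_mul]; exact htwo c' hcD u hu)
    (by
      rintro (i | j)
      · convert hZ (P i i - 4 * k2 i) using 1
        rw [hc'1, hg.ll, Matrix.of_apply]
        push_cast; ring
      · convert hZ (- k3 j) using 1
        have h6 := hg.rr j j
        rw [Matrix.of_apply] at h6
        push_cast
        linear_combination (h6 - hc'2 j) / 2)
  refine ⟨c, c', memD, memA, hAD, htwo, hcA, hcD, fun u hu => ?_, fun d hd => ?_, ?_, ?_, ?_, ?_⟩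
  · convert hchar u hu using 1; ring
  · convert hchar' d hd using 1; ring
  · convert hZ (k4 + 2 * ∑ i, x i * k1 i) using 1
    rw [hcc]; push_cast; ring
  · convert hZ (∑ i, x i * k1 i + 2 * ∑ i, y i * k2 i + k5 - 2 * ∑ i, x i * k2 i) using 1
    have h6 : inner ℝ c' c' = (8 * ((∑ i, y i * k2 i : ℤ) : ℝ) + (4 * k5 - 2 * k4)) / 2 := by
      rw [← hc'c']; ring
    rw [hcc, hcc', h6]
    push_cast
    ring
  · obtain ⟨u, hu, hu'⟩ := hodd
    exact ⟨u, le_loc hu, hu'⟩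
  · obtain ⟨u, hu, hu'⟩ := hodd
    obtain ⟨d, rfl⟩ := hsurj u
    refine ⟨d, (hτmap d).2 (le_loc hu), fun hd => hu' ?_⟩
    convert hd using 1
    rw [hτ]; ring

end CharVectors

/-! ### The derived lattices -/

section Derived

variable {n : ℕ} {L M : Submodule ℤ (EuclideanSpace ℝ (Fin n))} {p : ℕ} {hp : p.Prime}

theorem loc_eq_of_two_nsmul_mem (hp2 : p ≠ 2) (h1 : ∀ x ∈ L, 2 • x ∈ M) (h2 : M ≤ L) :
    loc p hp M = loc p hp L := by
  refine le_antisymm (loc_mono h2) ?_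
  rintro x ⟨k, hk, hx⟩
  refine mem_loc_of_nsmul hk (mem_loc_of_nsmul (k := 2) (fun hd => hp2 ?_) (le_loc (h1 _ hx)))
  exact (Nat.prime_dvd_prime_iff_eq hp Nat.prime_two).1 hd

theorem IsIntegral.isPInt_inner (hL : IsIntegral L) {x y : EuclideanSpace ℝ (Fin n)}
    (hx : x ∈ loc p hp L) (hy : y ∈ loc p hp L) : IsPInt p (inner ℝ x y) := by
  obtain ⟨k, hk, hx⟩ := hx
  obtain ⟨l, hl, hy⟩ := hy
  refine IsPInt.of_nat_mul hp hk (IsPInt.of_nat_mul hp hl ?_)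
  rw [← inner_nsmul_left', real_inner_comm, ← inner_nsmul_left', real_inner_comm]
  obtain ⟨m, hm⟩ := hL.integral _ hx _ hy
  rw [hm]
  exact IsPInt.intCast hp m

theorem IsPInt.half_of_ne_two {x : ℝ} (hx : IsPInt p x) (hp : p.Prime) (hp2 : p ≠ 2) :
    IsPInt p (x / 2) := by
  refine IsPInt.of_nat_mul hp (k := 2) (fun hd => hp2 ?_) ?_
  · exact (Nat.prime_dvd_prime_iff_eq hp Nat.prime_two).1 hd
  · convert hx using 1
    push_cast
    ring

theorem exists_odd_norm (h : IsOdd L) : ∃ u ∈ L, inner ℝ u u / 2 ∉ twoIntegers := by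
  by_contra! hcon
  refine h.2 ⟨h.1, fun u hu => ?_⟩
  obtain ⟨k, hk⟩ := exists_int_eq_of_forall_isPInt (x := inner ℝ u u / 2) fun p hp => by
    by_cases hp2 : p = 2
    · subst hp2
      exact hcon u hu
    · exact (h.1.isPInt_inner (hp := hp) (le_loc hu) (le_loc hu)).half_of_ne_two hp hp2
  exact ⟨k, by rw [← hk]; ring⟩

theorem IsIntegral.mem_evenSublattice_iff (h : IsIntegral L) {u : EuclideanSpace ℝ (Fin n)} :
    u ∈ evenSublattice L ↔ u ∈ L ∧ inner ℝ u u / 2 ∈ twoIntegers :=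
  mem_evenSublattice (fun _ hu _ hv =>
    h.isPInt_inner (hp := Nat.prime_two) (le_loc hu) (le_loc hv)) u

theorem inner_two_nsmul_self (x : EuclideanSpace ℝ (Fin n)) :
    inner ℝ (2 • x) (2 • x) = 4 * inner ℝ x x := by
  rw [inner_nsmul_left', real_inner_comm, inner_nsmul_left']
  push_cast; ring

theorem IsIntegral.two_nsmul_mem_evenSublattice (h : IsIntegral L) {x : EuclideanSpace ℝ (Fin n)}
    (hx : x ∈ L) : 2 • x ∈ evenSublattice L := by
  refine h.mem_evenSublattice_iff.2 ⟨nsmul_mem hx 2, ?_⟩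
  convert two_mul_mem (h.isPInt_inner (hp := Nat.prime_two) (le_loc hx) (le_loc hx)) using 1
  rw [inner_two_nsmul_self]; ring

theorem IsIntegral.evenSublattice_le (h : IsIntegral L) : evenSublattice L ≤ L :=
  fun _ hx => (h.mem_evenSublattice_iff.1 hx).1

theorem IsIntegral.isRational_evenSublattice (h : IsIntegral L) : IsRational (evenSublattice L) :=
  h.isRational.of_commensurable two_ne_zero (fun _ hx => h.two_nsmul_mem_evenSublattice hx)
    fun _ hx => nsmul_mem (h.evenSublattice_le hx) 2

theorem not_dvd_mul_self (hp : p.Prime) {k : ℕ} (hk : ¬ p ∣ k) : ¬ p ∣ k * k :=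
  fun hd => hk (or_self_iff.1 ((hp.dvd_mul).1 hd))

theorem inner_nsmul_self (k : ℕ) (x : EuclideanSpace ℝ (Fin n)) :
    inner ℝ (k • x) (k • x) = (k * k : ℕ) * inner ℝ x x := by
  rw [inner_nsmul_left', real_inner_comm, inner_nsmul_left']
  push_cast; ring

theorem IsIntegral.inEvenDual_iff (h : IsIntegral L) {x : EuclideanSpace ℝ (Fin n)} :
    InEvenDual (loc 2 Nat.prime_two L) x ↔ x ∈ loc 2 Nat.prime_two (dual (evenSublattice L)) := by
  rw [mem_loc_dual_iff h.isRational_evenSublattice.isLattice]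
  constructor
  · intro hx u hu
    obtain ⟨h1, h2⟩ := h.mem_evenSublattice_iff.1 hu
    exact hx u (le_loc h1) h2
  · rintro hx u ⟨k, hk, hu⟩ hev
    refine IsPInt.of_nat_mul Nat.prime_two hk ?_
    rw [real_inner_comm, ← inner_nsmul_left', real_inner_comm]
    refine hx _ (h.mem_evenSublattice_iff.2 ⟨hu, ?_⟩)
    rw [inner_nsmul_self, mul_div_assoc]
    exact int_mul_mem (k * k : ℕ) hev

theorem loc_two_twoDual (h : IsRational L) :
    loc 2 Nat.prime_two (twoDual L) = loc 2 Nat.prime_two (dual L) :=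
  loc_piDual_of_mem h rfl

theorem loc_twoDual_of_ne_two (h : IsRational L) (hp2 : p ≠ 2) :
    loc p hp (twoDual L) = loc p hp L :=
  loc_piDual_of_notMem h fun h' => hp2 (congrArg Subtype.val h')

theorem scale_scale {c d : ℝ} (hc : c ≠ 0) (hd : d ≠ 0) :
    scale c (scale d L) = scale (c * d) L := by
  ext x
  rw [mem_scale_iff hc, mem_scale_iff hd, mem_scale_iff (mul_ne_zero hc hd), smul_smul, mul_inv_rev]

theorem scale_one : scale 1 L = L := by
  ext x
  rw [mem_scale_iff one_ne_zero, inv_one, one_smul]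

theorem mem_loc_scale_iff {c : ℝ} (hc : c ≠ 0) {x : EuclideanSpace ℝ (Fin n)} :
    x ∈ loc p hp (scale c L) ↔ c⁻¹ • x ∈ loc p hp L := by
  rw [mem_loc_iff, mem_loc_iff]
  refine exists_congr fun k => and_congr_right fun _ => ?_
  rw [mem_scale_iff hc, smul_comm]

theorem mem_dual_scale_iff {c : ℝ} {x : EuclideanSpace ℝ (Fin n)} :
    x ∈ dual (scale c L) ↔ c • x ∈ dual L := by
  rw [mem_dual_iff, mem_dual_iff]
  constructor
  · intro hx u hu
    rw [real_inner_smul_left, ← real_inner_smul_right]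
    exact hx _ (smul_mem_scale c hu)
  · rintro hx _ ⟨u, hu, rfl⟩
    change ∃ k : ℤ, inner ℝ x (c • u) = k
    rw [real_inner_smul_right, ← real_inner_smul_left]
    exact hx u hu

/-- Rescaling by `√2` commutes with taking the `2`-dual up to inverting the scalar. -/
theorem scale_sqrt_two_twoDual_scale (h : IsRational L) :
    scale (Real.sqrt 2) (twoDual (scale (Real.sqrt 2) L)) = twoDual L := by
  have hs : Real.sqrt 2 ≠ 0 := by positivity
  have hss : Real.sqrt 2 * Real.sqrt 2 = 2 := Real.mul_self_sqrt zero_le_two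
  have hs2 : IsRational (scale (Real.sqrt 2) L) := by
    refine ⟨h.isLattice.scale hs, ?_⟩
    rintro _ ⟨u, hu, rfl⟩ _ ⟨v, hv, rfl⟩
    obtain ⟨q, hq⟩ := h.rational u hu v hv
    refine ⟨2 * q, ?_⟩
    change inner ℝ (Real.sqrt 2 • u) (Real.sqrt 2 • v) = _
    rw [real_inner_smul_left, real_inner_smul_right, ← mul_assoc, hss, hq]
    push_cast
    rfl
  ext x
  rw [mem_scale_iff hs, twoDual, twoDual, mem_piDual_iff hs2, mem_piDual_iff h]
  refine and_congr (forall₂_congr fun p hp => ?_) (forall₂_congr fun p hp => ?_)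
  · rw [mem_loc_iff, mem_loc_iff]
    refine exists_congr fun k => and_congr_right fun _ => ?_
    rw [mem_dual_scale_iff, smul_comm k, smul_smul, mul_inv_cancel₀ hs, one_smul]
  · have hp2 : ¬ (p : ℕ) ∣ 2 := fun hd =>
      hp (Subtype.ext ((Nat.prime_dvd_prime_iff_eq p.2 Nat.prime_two).1 hd))
    have h2 : (2 : ℕ) • (Real.sqrt 2)⁻¹ • (Real.sqrt 2)⁻¹ • x = x := by
      rw [← Nat.cast_smul_eq_nsmul ℝ, smul_smul, smul_smul, mul_assoc]
      have : ((2 : ℕ) : ℝ) * ((Real.sqrt 2)⁻¹ * (Real.sqrt 2)⁻¹) = 1 := by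
        rw [← mul_inv, hss]; norm_num
      rw [this, one_smul]
    rw [mem_loc_scale_iff hs]
    constructor
    · intro hx
      rw [← h2]
      exact nsmul_mem hx 2
    · intro hx
      exact mem_loc_of_nsmul hp2 (by rwa [h2])

/-- The lattice of vectors of 2-integral norm in the 2-dual of the even sublattice of `L`, encoded
as the even sublattice of the derived lattice divided by `√2` (see `mem_shadowLattice_iff`). -/
noncomputable def shadowLattice (L : Submodule ℤ (EuclideanSpace ℝ (Fin n))) :
    Submodule ℤ (EuclideanSpace ℝ (Fin n)) :=
  scale (Real.sqrt 2)⁻¹ (evenSublattice (derived L))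

section WithSetup

variable {c c' : EuclideanSpace ℝ (Fin n)} (hL : IsIntegral L)
  (hset : LocalSetup (loc 2 Nat.prime_two L) (loc 2 Nat.prime_two (dual L)) c c')

include hL

theorem loc_twoDual_evenSublattice (hp2 : p ≠ 2) :
    loc p hp (twoDual (evenSublattice L)) = loc p hp L := by
  rw [loc_twoDual_of_ne_two hL.isRational_evenSublattice hp2]
  exact loc_eq_of_two_nsmul_mem hp2 (fun _ hx => hL.two_nsmul_mem_evenSublattice hx)
    hL.evenSublattice_le

theorem mem_loc_two_twoDual_evenSublattice {x : EuclideanSpace ℝ (Fin n)} :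
    x ∈ loc 2 Nat.prime_two (twoDual (evenSublattice L)) ↔
      InEvenDual (loc 2 Nat.prime_two L) x := by
  rw [loc_two_twoDual hL.isRational_evenSublattice, hL.inEvenDual_iff]

include hset

theorem isIntegral_derived : IsIntegral (derived L) := by
  have hs : Real.sqrt 2 ≠ 0 := by positivity
  have hss : Real.sqrt 2 * Real.sqrt 2 = 2 := Real.mul_self_sqrt zero_le_two
  refine ⟨(hL.isRational_evenSublattice.piDual _).isLattice.scale hs, ?_⟩
  rintro _ ⟨x, hx, rfl⟩ _ ⟨y, hy, rfl⟩
  change ∃ k : ℤ, inner ℝ (Real.sqrt 2 • x) (Real.sqrt 2 • y) = k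
  rw [real_inner_smul_left, real_inner_smul_right, ← mul_assoc, hss]
  refine exists_int_eq_of_forall_isPInt fun p hp => ?_
  by_cases hp2 : p = 2
  · subst hp2
    exact hset.two_mul_inner_mem ((mem_loc_two_twoDual_evenSublattice hL).1 (le_loc hx))
      ((mem_loc_two_twoDual_evenSublattice hL).1 (le_loc hy))
  · have h1 : IsPInt p (inner ℝ x y) := by
      refine hL.isPInt_inner (hp := hp) ?_ ?_
      · rw [← loc_twoDual_evenSublattice hL hp2]; exact le_loc hx
      · rw [← loc_twoDual_evenSublattice hL hp2]; exact le_loc hy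
    simpa using h1.int_mul 2

theorem mem_shadowLattice_iff {x : EuclideanSpace ℝ (Fin n)} :
    x ∈ shadowLattice L ↔ x ∈ twoDual (evenSublattice L) ∧ inner ℝ x x ∈ twoIntegers := by
  have hs : Real.sqrt 2 ≠ 0 := by positivity
  have hss : Real.sqrt 2 * Real.sqrt 2 = 2 := Real.mul_self_sqrt zero_le_two
  rw [shadowLattice, mem_scale_iff (inv_ne_zero hs), inv_inv,
    (isIntegral_derived hL hset).mem_evenSublattice_iff, derived, mem_scale_iff hs, smul_smul,
    inv_mul_cancel₀ hs, one_smul, real_inner_smul_left, real_inner_smul_right, ← mul_assoc, hss,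
    mul_div_cancel_left₀ _ two_ne_zero]

theorem shadowLattice_le : shadowLattice L ≤ twoDual (evenSublattice L) :=
  fun _ hx => ((mem_shadowLattice_iff hL hset).1 hx).1

theorem two_nsmul_mem_shadowLattice {x : EuclideanSpace ℝ (Fin n)}
    (hx : x ∈ twoDual (evenSublattice L)) : 2 • x ∈ shadowLattice L := by
  refine (mem_shadowLattice_iff hL hset).2 ⟨nsmul_mem hx 2, ?_⟩
  have h1 := (mem_loc_two_twoDual_evenSublattice hL).1 (le_loc hx)
  convert two_mul_mem (hset.two_mul_inner_mem h1 h1) using 1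
  rw [inner_two_nsmul_self]; ring

theorem isRational_shadowLattice : IsRational (shadowLattice L) :=
  (hL.isRational_evenSublattice.piDual _).of_commensurable two_ne_zero
    (fun _ hx => two_nsmul_mem_shadowLattice hL hset hx)
    fun _ hx => nsmul_mem (shadowLattice_le hL hset hx) 2

theorem loc_shadowLattice (hp2 : p ≠ 2) : loc p hp (shadowLattice L) = loc p hp L := by
  rw [← loc_twoDual_evenSublattice hL hp2]
  exact loc_eq_of_two_nsmul_mem hp2 (fun _ hx => two_nsmul_mem_shadowLattice hL hset hx)
    (shadowLattice_le hL hset)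

theorem mem_loc_two_shadowLattice {x : EuclideanSpace ℝ (Fin n)} :
    x ∈ loc 2 Nat.prime_two (shadowLattice L) ↔ InShadow (loc 2 Nat.prime_two L) x := by
  rw [InShadow, ← mem_loc_two_twoDual_evenSublattice hL]
  constructor
  · rintro ⟨k, hk, hx⟩
    obtain ⟨h1, h2⟩ := (mem_shadowLattice_iff hL hset).1 hx
    rw [inner_nsmul_self] at h2
    exact ⟨⟨k, hk, h1⟩, IsPInt.of_nat_mul Nat.prime_two (not_dvd_mul_self Nat.prime_two hk) h2⟩
  · rintro ⟨⟨k, hk, h1⟩, h2⟩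
    refine ⟨k, hk, (mem_shadowLattice_iff hL hset).2 ⟨h1, ?_⟩⟩
    rw [inner_nsmul_self]
    exact int_mul_mem (k * k : ℕ) h2

theorem derived_derived_eq : derived (derived L) = twoDual (shadowLattice L) := by
  have hs : Real.sqrt 2 ≠ 0 := by positivity
  have h1 : evenSublattice (derived L) = scale (Real.sqrt 2) (shadowLattice L) := by
    rw [shadowLattice, scale_scale hs (inv_ne_zero hs), mul_inv_cancel₀ hs, scale_one]
  rw [derived, h1, scale_sqrt_two_twoDual_scale (isRational_shadowLattice hL hset)]

theorem isRational_derived_derived : IsRational (derived (derived L)) := by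
  rw [derived_derived_eq hL hset]
  exact (isRational_shadowLattice hL hset).piDual _

theorem ratSpan_derived_derived : ratSpan (derived (derived L)) = ratSpan L := by
  rw [derived_derived_eq hL hset, twoDual, ratSpan_piDual (isRational_shadowLattice hL hset),
    ratSpan_eq_of_commensurable (L := twoDual (evenSublattice L)) two_ne_zero
      (fun _ hx => two_nsmul_mem_shadowLattice hL hset hx)
      fun _ hx => nsmul_mem (shadowLattice_le hL hset hx) 2,
    twoDual, ratSpan_piDual hL.isRational_evenSublattice,
    ratSpan_eq_of_commensurable two_ne_zero (fun _ hx => hL.two_nsmul_mem_evenSublattice hx)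
      fun _ hx => nsmul_mem (hL.evenSublattice_le hx) 2]

theorem loc_derived_derived (hp2 : p ≠ 2) : loc p hp (derived (derived L)) = loc p hp L := by
  rw [derived_derived_eq hL hset, loc_twoDual_of_ne_two (isRational_shadowLattice hL hset) hp2,
    loc_shadowLattice hL hset hp2]

theorem mem_loc_two_derived_derived {x : EuclideanSpace ℝ (Fin n)} :
    x ∈ loc 2 Nat.prime_two (derived (derived L)) ↔ InDerived (loc 2 Nat.prime_two L) x := by
  rw [derived_derived_eq hL hset, loc_two_twoDual (isRational_shadowLattice hL hset),
    mem_loc_dual_iff_loc (isRational_shadowLattice hL hset).isLattice]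
  exact forall_congr' fun u => by rw [mem_loc_two_shadowLattice hL hset]; rfl

theorem mem_loc_two_dual_derived_derived {x : EuclideanSpace ℝ (Fin n)} :
    x ∈ loc 2 Nat.prime_two (dual (derived (derived L))) ↔
      InShadow (loc 2 Nat.prime_two L) x := by
  have hK := isRational_shadowLattice hL hset
  have h1 : loc 2 Nat.prime_two (dual (derived (derived L)))
      = loc 2 Nat.prime_two (dual (dual (shadowLattice L))) := by
    refine loc_dual_congr (isRational_derived_derived hL hset).isLattice hK.isLattice.dual ?_
    rw [derived_derived_eq hL hset, loc_two_twoDual hK]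
  rw [h1, hK.isLattice.dual_dual, mem_loc_two_shadowLattice hL hset]

theorem isEven_derived_derived : IsEven (derived (derived L)) := by
  have hev : ∀ u ∈ derived (derived L), ∃ k : ℤ, inner ℝ u u / 2 = k := by
    intro u hu
    refine exists_int_eq_of_forall_isPInt fun p hp => ?_
    by_cases hp2 : p = 2
    · subst hp2
      exact hset.norm_even_of_inDerived ((mem_loc_two_derived_derived hL hset).1 (le_loc hu))
    · have h1 : u ∈ loc p hp L := by rw [← loc_derived_derived hL hset hp2]; exact le_loc hu
      exact (hL.isPInt_inner h1 h1).half_of_ne_two hp hp2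
  refine ⟨⟨(isRational_derived_derived hL hset).isLattice, fun u hu v hv => ?_⟩, fun u hu => ?_⟩
  · obtain ⟨a, ha⟩ := hev u hu
    obtain ⟨b, hb⟩ := hev v hv
    obtain ⟨c, hc⟩ := hev (u + v) (add_mem hu hv)
    refine ⟨c - a - b, ?_⟩
    rw [real_inner_add_add_self] at hc
    push_cast
    linarith
  · obtain ⟨k, hk⟩ := hev u hu
    exact ⟨k, by rw [← hk]; ring⟩

/-- Every modularity of `L` is a modularity of the twice derived lattice. The similarity `τ` of
norm 2 identifies the dual of `L` at 2 with `L`. -/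
theorem isModularity_derived_derived
    {τ : EuclideanSpace ℝ (Fin n) →ₗ[ℝ] EuclideanSpace ℝ (Fin n)} (hτ : MultipliesNormsBy 2 τ)
    (hτmap : ∀ x, x ∈ loc 2 Nat.prime_two (dual L) ↔ τ x ∈ loc 2 Nat.prime_two L)
    {σ : EuclideanSpace ℝ (Fin n) →ₗ[ℝ] EuclideanSpace ℝ (Fin n)} (hσ : IsModularity L σ) :
    IsModularity (derived (derived L)) σ := by
  obtain ⟨⟨N, hN, hσN⟩, S, hS⟩ := hσ
  refine ⟨⟨N, hN, hσN⟩, S, ?_⟩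
  have hinj := injective_of_multipliesNormsBy hN.ne' hσN
  have hsurj : Function.Surjective σ := LinearMap.injective_iff_surjective.1 hinj
  have hτsurj : Function.Surjective τ :=
    LinearMap.injective_iff_surjective.1 (injective_of_multipliesNormsBy two_ne_zero hτ)
  have hloc := fun p hp => mem_loc_piDual_iff_map_mem (p := p) (hp := hp) hinj hS
  have hrat := isRational_derived_derived hL hset
  have hA : ∀ u ∈ loc 2 Nat.prime_two L, inner ℝ u u ∈ twoIntegers := fun u hu =>
    hL.isPInt_inner hu hu
  have hmem : ∀ x, x ∈ piDual S (derived (derived L)) ↔ σ x ∈ derived (derived L) := by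
    intro x
    have key : ∀ (p : ℕ) (hp : p.Prime), x ∈ loc p hp (piDual S (derived (derived L))) ↔
        σ x ∈ loc p hp (derived (derived L)) := by
      intro p hp
      by_cases hpS : (⟨p, hp⟩ : Nat.Primes) ∈ S
      · have h1 := hloc p hp
        simp_rw [loc_piDual_of_mem hL.isRational hpS] at h1
        rw [loc_piDual_of_mem hrat hpS]
        by_cases hp2 : p = 2
        · subst hp2
          obtain ⟨n1, n2⟩ := half_mem_and_two_div_mem_of_map_eq hA hset.odd hτ hτmap hτsurj hσN
            hN.ne' h1 hsurj
          rw [mem_loc_two_dual_derived_derived hL hset, mem_loc_two_derived_derived hL hset]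
          exact hset.inShadow_iff_inDerived_map hσN hN.ne' n1 n2 h1 hsurj x
        · rw [loc_dual_congr hrat.isLattice hL.isLattice (loc_derived_derived hL hset hp2),
            loc_derived_derived hL hset hp2]
          exact h1 x
      · have h1 := hloc p hp
        simp_rw [loc_piDual_of_notMem hL.isRational hpS] at h1
        rw [loc_piDual_of_notMem hrat hpS]
        by_cases hp2 : p = 2
        · subst hp2
          obtain ⟨n1, n2⟩ := mem_and_inv_mem_of_map_eq hA hset.odd hσN hN.ne' h1 hsurj
          rw [mem_loc_two_derived_derived hL hset, mem_loc_two_derived_derived hL hset]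
          exact inDerived_map_iff hσN hN.ne' n1 n2 h1 hsurj x
        · rw [loc_derived_derived hL hset hp2]
          exact h1 x
    constructor
    · intro hx
      exact mem_of_forall_mem_loc hrat.isLattice fun p hp => (key p hp).1 (le_loc hx)
    · intro hx
      exact mem_of_forall_mem_loc (hrat.piDual S).isLattice fun p hp => (key p hp).2 (le_loc hx)
  ext y
  obtain ⟨x, rfl⟩ := hsurj y
  rw [hinj.mem_set_image]
  exact hmem x

end WithSetup

end Derived

/-- The set of primes of a level 2 modularity of an odd lattice contains 2. -/
theorem two_mem_of_level_two {n : ℕ} {L : Submodule ℤ (EuclideanSpace ℝ (Fin n))}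
    (hL : IsIntegral L) (hodd : ∃ u ∈ L, inner ℝ u u / 2 ∉ twoIntegers)
    {τ : EuclideanSpace ℝ (Fin n) →ₗ[ℝ] EuclideanSpace ℝ (Fin n)} (hτ : MultipliesNormsBy 2 τ)
    {S : Set Nat.Primes} (hS : τ '' (piDual S L : Set (EuclideanSpace ℝ (Fin n))) = L) :
    (⟨2, Nat.prime_two⟩ : Nat.Primes) ∈ S := by
  by_contra h2
  have hinj := injective_of_multipliesNormsBy two_ne_zero hτ
  have h1 := mem_loc_piDual_iff_map_mem (p := 2) (hp := Nat.prime_two) hinj hS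
  simp_rw [loc_piDual_of_notMem hL.isRational h2] at h1
  obtain ⟨u, hu, hun⟩ := hodd
  obtain ⟨v, rfl⟩ := LinearMap.injective_iff_surjective.1 hinj u
  have hv := (h1 v).2 (le_loc hu)
  apply hun
  rw [hτ, mul_div_cancel_left₀ _ two_ne_zero]
  exact hL.isPInt_inner hv hv

end ModularLattice

theorem theorem4 (n : ℕ) (L : Submodule ℤ (EuclideanSpace ℝ (Fin n)))
    (hodd : ModularLattice.IsOdd L)
    (hmod : ModularLattice.IsModular {2} L)
    (hdim : 4 ∣ n)
    (o : ZMod 8) (ho : ModularLattice.HasOddity L o) (ho4 : o = 0 ∨ o = 4) :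
    ModularLattice.IsIntegral (ModularLattice.derived L) ∧
    ModularLattice.IsEven (ModularLattice.derived (ModularLattice.derived L)) ∧
    ModularLattice.IsModular {2} (ModularLattice.derived (ModularLattice.derived L)) ∧
    ModularLattice.RationallyEquivalent L (ModularLattice.derived (ModularLattice.derived L)) ∧
    (∀ σ : EuclideanSpace ℝ (Fin n) →ₗ[ℝ] EuclideanSpace ℝ (Fin n),
      ModularLattice.IsModularity L σ →
        ModularLattice.IsModularity (ModularLattice.derived (ModularLattice.derived L)) σ) := by
  obtain ⟨hL, hlev⟩ := hmod
  have hu := ModularLattice.exists_odd_norm hodd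
  obtain ⟨τ, ⟨hτ1, S, hS⟩, hτ⟩ := hlev 2 rfl
  have hτ : ModularLattice.MultipliesNormsBy 2 τ := by exact_mod_cast hτ
  have h2S := ModularLattice.two_mem_of_level_two hL hu hτ hS
  obtain ⟨c, c', hset⟩ := ModularLattice.exists_localSetup hL hu hdim ho ho4 hτ h2S hS
  have hτmap := ModularLattice.mem_loc_piDual_iff_map_mem (p := 2) (hp := Nat.prime_two)
    (ModularLattice.injective_of_multipliesNormsBy two_ne_zero hτ) hS
  simp_rw [ModularLattice.loc_piDual_of_mem hL.isRational h2S] at hτmap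
  have hmodularity := fun σ hσ =>
    ModularLattice.isModularity_derived_derived hL hset hτ hτmap (σ := σ) hσ
  have heven := ModularLattice.isEven_derived_derived hL hset
  refine ⟨ModularLattice.isIntegral_derived hL hset, heven, ⟨heven.toIsIntegral, fun l hl => ?_⟩,
    ⟨LinearEquiv.ofEq _ _ (ModularLattice.ratSpan_derived_derived hL hset).symm, fun x y => rfl⟩,
    hmodularity⟩
  obtain ⟨σ, hσ, hσl⟩ := hlev l hl
  exact ⟨σ, hmodularity σ hσ, hσl⟩
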